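/- Let $(W,S)$ be a Coxeter system, with $n(s,t)\in\{1,2,\dots\}\cup\{\infty\}$ the entries of its Coxeter matrix, and let $H$ be its Hecke algebra over $\mathbb{Q}(u)$, generated by $T_s$ ($s\in S$) with relations $(T_s-u^2)(T_s+1)=0$ for $s\in S$, and $T_sT_tT_s\cdots=T_tT_sT_t\cdots$ ($n(s,t)$ factors on each side) whenever $1<n(s,t)<\infty$. An *$S$-labeled digraph* is a directed multigraph $\Gamma$ without loops, each of whose edges is solid or dashed and is labeled by an element of $S$, such that for every $s\in S$ every vertex occurs in exactly one edge labeled $s$. Let $M(\Gamma)$ be the $\mathbb{Q}(u)$-vector space with basis the vertices of $\Gamma$, and let $\tau_s$ be the linear operator on $M(\Gamma)$ with $$\tau_s(\alpha)=\begin{cases}\beta & \text{if there is a solid edge }\alpha\to\beta\text{ labeled }s,\\ (u^2-1)\alpha+u^2\beta & \text{if there is a solid edge }\beta\to\alpha\text{ labeled }s,\\ u\alpha+(u+1)\beta & \text{if there is a dashed edge }\alpha\to\beta\text{ labeled }s,\\ (u^2-u-1)\alpha+(u^2-u)\beta & \text{if there is a dashed edge }\beta\to\alpha\text{ labeled }s.\end{cases}$$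 $\Gamma$ is a *$W$-digraph* if it is an $S$-labeled digraph and $T_s\mapsto\tau_s$ extends to a homomorphism of $\mathbb{Q}(u)$-algebras $H\to\operatorname{End}_{\mathbb{Q}(u)}(M(\Gamma))$. Isomorphisms are bijections of the vertices preserving and reflecting edges together with their directions, labels and types. For $s\neq t$ in $S$ and $m\ge 2$, consider the digraphs with $2m$ vertices $\alpha_0,\dots,\alpha_{m-1},\beta_1,\dots,\beta_m$ and with edges $\alpha_0\to\alpha_1\to\cdots\to\alpha_{m-1}\to\beta_m$, labeled alternately $s,t,s,\dots$, and $\alpha_0\to\beta_1\to\cdots\to\beta_{m-1}\to\beta_m$, labeled alternately $t,s,t,\dots$. All edges are solid except for the following dashed ones: 1. none; 2. $\alpha_0\to\alpha_1$ and $\beta_{m-1}\to\beta_m$; 3. $\alpha_0\to\beta_1$ and $\alpha_{m-1}\to\beta_m$; 4. $\alpha_0\to\alpha_1$ and $\alpha_0\to\beta_1$; 5. $\alpha_{m-1}\to\beta_m$ and $\beta_{m-1}\to\beta_m$; 6. $\alpha_0\to\alpha_1$, $\alpha_0\to\beta_1$, $\alpha_{m-1}\to\beta_m$ and $\beta_{m-1}\to\beta_m$.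 Moreover, let families 7 and 8 (with $m=1$) each consist of one digraph, with two vertices $\alpha_0,\beta_1$ and two edges $\alpha_0\to\beta_1$, labeled $s$ and $t$, both solid in family 7 and both dashed in family 8. **Theorem.** The following are equivalent for a directed multigraph $\Gamma$ with solid or dashed edges labeled by elements of $S$. (a) $\Gamma$ is a $W$-digraph. (b) $\Gamma$ is an $S$-labeled digraph such that for all $s,t\in S$ with $1<n=n(s,t)<\infty$, each connected component of the subdigraph $\Gamma_{\{s,t\}}$ (all the vertices, and the edges labeled $s$ or $t$) is isomorphic to one of the digraphs above, with (i) $m\ge 2$ and $m\mid n$ in families 1, 2, 3; (ii) $m\ge 2$ and $(2m-1)\mid n$ in families 4, 5; (iii) $m\ge 2$ and $(2m-2)\mid n$ in family 6; (iv) $m=1$ and $n\ge 2$ arbitrary in families 7, 8. -/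

import Mathlib

noncomputable section

/-! ### Hecke algebras -/

/-- The field `ℚ(u)` of rational functions in the indeterminate `u`. -/
abbrev Qu : Type := RatFunc ℚ

/-- The indeterminate `u` of `ℚ(u)`. -/
def u : Qu := RatFunc.X

/-- The alternating product `a b a ⋯` with `n` factors, starting with `a` on the left. -/
def altProd {A : Type*} [Monoid A] : A → A → ℕ → A
  | _, _, 0 => 1
  | a, b, n + 1 => a * altProd b a n

/-- The defining relations of the Hecke algebra: `(T_s - u²)(T_s + 1) = 0` for all `s`, and
`T_s T_t ⋯ = T_t T_s ⋯` (with `n(s,t)` factors on each side) whenever `1 < n(s,t) < ∞`.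
In a `CoxeterMatrix` the value `∞` is encoded by `0`. -/
inductive HeckeRel {S : Type*} (M : CoxeterMatrix S) :
    FreeAlgebra Qu S → FreeAlgebra Qu S → Prop
  | quadratic (s : S) :
      HeckeRel M
        ((FreeAlgebra.ι Qu s - algebraMap Qu (FreeAlgebra Qu S) (u ^ 2)) * (FreeAlgebra.ι Qu s + 1))
        0
  | braid (s t : S) (h : 1 < M s t) :
      HeckeRel M
        (altProd (FreeAlgebra.ι Qu s) (FreeAlgebra.ι Qu t) (M s t))
        (altProd (FreeAlgebra.ι Qu t) (FreeAlgebra.ι Qu s) (M s t))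

/-- The Hecke algebra `H` over `ℚ(u)` of the Coxeter system `(W, S)`, by generators and
relations. -/
abbrev HeckeAlgebra {S W : Type*} [Group W] {M : CoxeterMatrix S} (_cs : CoxeterSystem M W) :
    Type _ :=
  RingQuot (HeckeRel M)

/-- The generator `T_s` of the Hecke algebra. -/
def HeckeAlgebra.T {S W : Type*} [Group W] {M : CoxeterMatrix S} (cs : CoxeterSystem M W)
    (s : S) : HeckeAlgebra cs :=
  RingQuot.mkAlgHom Qu (HeckeRel M) (FreeAlgebra.ι Qu s)

/-! ### Labeled digraphs -/

/-- The two types of edges. -/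
inductive EdgeKind
  | solid
  | dashed

/-- An edge `src ⟶ tgt`, solid or dashed, labeled by an element of `S`. -/
@[ext]
structure LabeledEdge (S V : Type*) where
  src : V
  tgt : V
  label : S
  kind : EdgeKind

/-- A directed multigraph with set of vertices `V`, all of whose edges are solid or dashed and
labeled by an element of `S`. -/
@[ext]
structure LabeledMultigraph (S V : Type*) where
  edges : Set (LabeledEdge S V)

namespace LabeledMultigraph

variable {S V V' : Type*}

/-- `Γ` is an `S`-labeled digraph: there are no loops and, for each `s ∈ S`, every vertex occurs in
exactly one edge labeled `s`. -/
structure IsLabeledDigraph (Γ : LabeledMultigraph S V) : Prop where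
  no_loops : ∀ e ∈ Γ.edges, e.src ≠ e.tgt
  existsUnique_edge : ∀ (s : S) (α : V),
    ∃! e : LabeledEdge S V, e ∈ Γ.edges ∧ e.label = s ∧ (e.src = α ∨ e.tgt = α)

/-- The vector space `M(Γ)` over `ℚ(u)` with basis the vertices of `Γ`. -/
abbrev Mod (_Γ : LabeledMultigraph S V) : Type _ := V →₀ Qu

/-- The vertex `α` as a basis element of `M(Γ)`. -/
def vec (Γ : LabeledMultigraph S V) (α : V) : Γ.Mod := Finsupp.single α 1

/-- In an `S`-labeled digraph, the unique edge labeled `s` in which `α` occurs. -/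
def IsLabeledDigraph.edge {Γ : LabeledMultigraph S V} (hΓ : Γ.IsLabeledDigraph) (s : S) (α : V) :
    LabeledEdge S V :=
  (hΓ.existsUnique_edge s α).choose

open Classical in
/-- The value of `τ_s` at the vertex `α`. -/
def tauVec {Γ : LabeledMultigraph S V} (hΓ : Γ.IsLabeledDigraph) (s : S) (α : V) : Γ.Mod :=
  if (hΓ.edge s α).src = α then
    match (hΓ.edge s α).kind with
    | .solid => Γ.vec (hΓ.edge s α).tgt
    | .dashed => u • Γ.vec α + (u + 1) • Γ.vec (hΓ.edge s α).tgt
  else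
    match (hΓ.edge s α).kind with
    | .solid => (u ^ 2 - 1) • Γ.vec α + u ^ 2 • Γ.vec (hΓ.edge s α).src
    | .dashed => (u ^ 2 - u - 1) • Γ.vec α + (u ^ 2 - u) • Γ.vec (hΓ.edge s α).src

/-- The linear operator `τ_s` on `M(Γ)`. -/
def tau {Γ : LabeledMultigraph S V} (hΓ : Γ.IsLabeledDigraph) (s : S) : Module.End Qu Γ.Mod :=
  Finsupp.linearCombination Qu (tauVec hΓ s)

section tau

variable {Γ : LabeledMultigraph S V} (hΓ : Γ.IsLabeledDigraph)

theorem edge_eq {e : LabeledEdge S V} (he : e ∈ Γ.edges) {α : V} (h : e.src = α ∨ e.tgt = α) :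
    hΓ.edge e.label α = e :=
  (hΓ.existsUnique_edge e.label α).unique (hΓ.existsUnique_edge e.label α).choose_spec.1
    ⟨he, rfl, h⟩

theorem tau_vec (s : S) (α : V) : tau hΓ s (Γ.vec α) = tauVec hΓ s α := by
  simp [tau, vec]

/-- `τ_s(α) = β` if there is a solid edge `α ⟶ β` labeled `s`. -/
theorem tau_solid_src {α β : V} {s : S} (h : ⟨α, β, s, .solid⟩ ∈ Γ.edges) :
    tau hΓ s (Γ.vec α) = Γ.vec β := by
  have := edge_eq hΓ h (α := α) (Or.inl rfl)
  simp only at this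
  simp [tau_vec, tauVec, this]

/-- `τ_s(α) = (u² - 1) α + u² β` if there is a solid edge `β ⟶ α` labeled `s`. -/
theorem tau_solid_tgt {α β : V} {s : S} (h : ⟨β, α, s, .solid⟩ ∈ Γ.edges) :
    tau hΓ s (Γ.vec α) = (u ^ 2 - 1) • Γ.vec α + u ^ 2 • Γ.vec β := by
  have := edge_eq hΓ h (α := α) (Or.inr rfl)
  have hne : β ≠ α := hΓ.no_loops _ h
  simp only at this
  simp [tau_vec, tauVec, this, hne]

/-- `τ_s(α) = u α + (u + 1) β` if there is a dashed edge `α ⟶ β` labeled `s`. -/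
theorem tau_dashed_src {α β : V} {s : S} (h : ⟨α, β, s, .dashed⟩ ∈ Γ.edges) :
    tau hΓ s (Γ.vec α) = u • Γ.vec α + (u + 1) • Γ.vec β := by
  have := edge_eq hΓ h (α := α) (Or.inl rfl)
  simp only at this
  simp [tau_vec, tauVec, this]

/-- `τ_s(α) = (u² - u - 1) α + (u² - u) β` if there is a dashed edge `β ⟶ α` labeled `s`. -/
theorem tau_dashed_tgt {α β : V} {s : S} (h : ⟨β, α, s, .dashed⟩ ∈ Γ.edges) :
    tau hΓ s (Γ.vec α) = (u ^ 2 - u - 1) • Γ.vec α + (u ^ 2 - u) • Γ.vec β := by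
  have := edge_eq hΓ h (α := α) (Or.inr rfl)
  have hne : β ≠ α := hΓ.no_loops _ h
  simp only at this
  simp [tau_vec, tauVec, this, hne]

end tau

/-- `Γ` is a `W`-digraph: it is an `S`-labeled digraph, and `T_s ↦ τ_s` extends to a homomorphism of
`ℚ(u)`-algebras from the Hecke algebra of `(W, S)` to the algebra of linear operators on `M(Γ)`. -/
def IsWDigraph {W : Type*} [Group W] {M : CoxeterMatrix S} (cs : CoxeterSystem M W)
    (Γ : LabeledMultigraph S V) : Prop :=
  ∃ hΓ : Γ.IsLabeledDigraph, ∃ ρ : HeckeAlgebra cs →ₐ[Qu] Module.End Qu Γ.Mod,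
    ∀ s : S, ρ (HeckeAlgebra.T cs s) = tau hΓ s

/-! ### Subdigraphs, components, isomorphisms -/

/-- `Γ_J`: the same vertices, and only those edges whose label lies in `J`. -/
def restrict (Γ : LabeledMultigraph S V) (J : Set S) : LabeledMultigraph S V where
  edges := {e ∈ Γ.edges | e.label ∈ J}

/-- The simple graph in which two distinct vertices are adjacent if they are joined by an edge
of `Γ` in some direction. It has the same connected components as `Γ`. -/
def underlying (Γ : LabeledMultigraph S V) : SimpleGraph V :=
  SimpleGraph.fromRel fun α β => ∃ e ∈ Γ.edges, e.src = α ∧ e.tgt = β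

/-- The full subdigraph of `Γ` on a set `A` of vertices. -/
def induce (Γ : LabeledMultigraph S V) (A : Set V) : LabeledMultigraph S A where
  edges := {e | ⟨e.src, e.tgt, e.label, e.kind⟩ ∈ Γ.edges}

/-- A connected component of `Γ`, as a digraph. -/
def component (Γ : LabeledMultigraph S V) (C : Γ.underlying.ConnectedComponent) :
    LabeledMultigraph S C.supp :=
  Γ.induce C.supp

/-- Isomorphism: a bijection of the vertices that preserves and reflects edges, their direction,
their label and their type. -/
def IsIsomorphic (Γ : LabeledMultigraph S V) (Γ' : LabeledMultigraph S V') : Prop :=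
  ∃ φ : V ≃ V', ∀ (α β : V) (s : S) (k : EdgeKind),
    ⟨α, β, s, k⟩ ∈ Γ.edges ↔ ⟨φ α, φ β, s, k⟩ ∈ Γ'.edges

end LabeledMultigraph

/-! ### The eight families of digraphs with labels `s`, `t` -/

/-- The `2m` vertices `α_0, …, α_{m-1}, β_1, …, β_m`. -/
inductive PolygonVertex (m : ℕ)
  | alpha (j : ℕ) (h : j < m)
  | beta (j : ℕ) (h₁ : 1 ≤ j) (h₂ : j ≤ m)

open PolygonVertex EdgeKind in
/-- The edges of the digraph

* `α_0 ⟶ α_1 ⟶ ⋯ ⟶ α_{m-1} ⟶ β_m`, labeled alternately `s, t, s, …`,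
* `α_0 ⟶ β_1 ⟶ ⋯ ⟶ β_{m-1} ⟶ β_m`, labeled alternately `t, s, t, …`,

where all edges are solid, except that the types of `α_0 ⟶ α_1`, `α_0 ⟶ β_1`, `α_{m-1} ⟶ β_m`,
`β_{m-1} ⟶ β_m` are `tl`, `tr`, `bl`, `br`, respectively. Used for `2 ≤ m` only. -/
inductive IsPolygonEdge {S : Type*} (s t : S) (m : ℕ) (tl tr bl br : EdgeKind) :
    LabeledEdge S (PolygonVertex m) → Prop
  | left (j : ℕ) (h : j + 1 < m) :
      IsPolygonEdge s t m tl tr bl br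
        ⟨alpha j (by omega), alpha (j + 1) h, if Even j then s else t,
          if j = 0 then tl else solid⟩
  | bottomLeft (h : 1 ≤ m) :
      IsPolygonEdge s t m tl tr bl br
        ⟨alpha (m - 1) (by omega), beta m h le_rfl, if Even m then t else s, bl⟩
  | topRight (h : 1 ≤ m) :
      IsPolygonEdge s t m tl tr bl br
        ⟨alpha 0 (by omega), beta 1 le_rfl h, t, tr⟩
  | right (j : ℕ) (h : 1 ≤ j) (h' : j + 1 ≤ m) :
      IsPolygonEdge s t m tl tr bl br
        ⟨beta j h (by omega), beta (j + 1) (by omega) h', if Even j then t else s,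
          if j + 1 = m then br else solid⟩

/-- The `2m`-gon with edges `IsPolygonEdge`. -/
def polygon {S : Type*} (s t : S) (m : ℕ) (tl tr bl br : EdgeKind) :
    LabeledMultigraph S (PolygonVertex m) where
  edges := {e | IsPolygonEdge s t m tl tr bl br e}

section Families

variable {S : Type*} (s t : S) (m : ℕ)

open EdgeKind

/-- All edges solid. -/
def family1 : LabeledMultigraph S (PolygonVertex m) := polygon s t m solid solid solid solid

/-- Dashed edges: `α_0 ⟶ α_1` and `β_{m-1} ⟶ β_m`. -/
def family2 : LabeledMultigraph S (PolygonVertex m) := polygon s t m dashed solid solid dashed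

/-- Dashed edges: `α_0 ⟶ β_1` and `α_{m-1} ⟶ β_m`. -/
def family3 : LabeledMultigraph S (PolygonVertex m) := polygon s t m solid dashed dashed solid

/-- Dashed edges: the two edges starting at `α_0`. -/
def family4 : LabeledMultigraph S (PolygonVertex m) := polygon s t m dashed dashed solid solid

/-- Dashed edges: the two edges ending at `β_m`. -/
def family5 : LabeledMultigraph S (PolygonVertex m) := polygon s t m solid solid dashed dashed

/-- Dashed edges: the two edges starting at `α_0` and the two edges ending at `β_m`. -/
def family6 : LabeledMultigraph S (PolygonVertex m) := polygon s t m dashed dashed dashed dashed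

/-- Two vertices `α_0`, `β_1` joined by two edges `α_0 ⟶ β_1`, labeled `s` and `t`, of the same
type `k`. -/
def bigon (k : EdgeKind) : LabeledMultigraph S (PolygonVertex 1) where
  edges := {⟨.alpha 0 one_pos, .beta 1 le_rfl le_rfl, s, k⟩,
    ⟨.alpha 0 one_pos, .beta 1 le_rfl le_rfl, t, k⟩}

/-- Two vertices joined by two solid edges in the same direction. -/
def family7 : LabeledMultigraph S (PolygonVertex 1) := bigon s t solid

/-- Two vertices joined by two dashed edges in the same direction. -/
def family8 : LabeledMultigraph S (PolygonVertex 1) := bigon s t dashed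

end Families

/-- `Δ` is isomorphic to a member of one of the eight families with labels `s`, `t` whose size is
subject to the divisibility condition for `n`. -/
def IsAdmissible {S V : Type*} (s t : S) (n : ℕ) (Δ : LabeledMultigraph S V) : Prop :=
  (∃ m : ℕ, 2 ≤ m ∧ m ∣ n ∧
    (Δ.IsIsomorphic (family1 s t m) ∨ Δ.IsIsomorphic (family2 s t m) ∨
      Δ.IsIsomorphic (family3 s t m))) ∨
  (∃ m : ℕ, 2 ≤ m ∧ 2 * m - 1 ∣ n ∧
    (Δ.IsIsomorphic (family4 s t m) ∨ Δ.IsIsomorphic (family5 s t m))) ∨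
  (∃ m : ℕ, 2 ≤ m ∧ 2 * m - 2 ∣ n ∧ Δ.IsIsomorphic (family6 s t m)) ∨
  Δ.IsIsomorphic (family7 s t) ∨ Δ.IsIsomorphic (family8 s t)

end

/-!
Both conditions reduce to one about a pair of labels `s ≠ t` with `1 < n = n(s, t) < ∞`, since the
quadratic relations hold automatically. Only the edges with these two labels matter, and
`M(Γ)` is the direct sum of the modules of the components of `Γ_{s,t}`. So the theorem says which
connected two-coloured graphs (`DihedralGraph`) satisfy the braid relation of length `n`.

Write `q = u²`, let `E_k` be the difference of the two alternating words with `k` factors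
(`altDiff`), and let `c = τ_s + τ_t - (q - 1)`. The quadratic relations give the Chebyshev
recurrence `E_{k+2} = c E_{k+1} - q E_k`, and show that the kernel of `E_k` is a submodule
(`altDiff_mul`).

*The graphs in the list satisfy the braid relations.* The source `α_0` generates the module, so it
suffices that `E_k α_0 = 0`. Near the sink, the sequence `e_k = E_k α_0` satisfies `e_m = 0` in
families 1, 2, 3, `e_m = -u e_{m-1}` in family 4, `e_m = u e_{m-1}` in family 5, and
`e_m = q e_{m-2}` in family 6. By the recurrence these symmetries extend to the whole sequence, and
`e_0 = 0` is reflected to `e_{2m-1} = 0` or `e_{2m-2} = 0`. In families 7 and 8 we have `τ_s = τ_t`.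

*There are no other graphs.* The coefficients of the operators are integral polynomials in `u`, so
a braid relation over `ℚ(u)` may be specialized to any value of `u` in any commutative ring
(`Braid.specialize`).

* At `u = 0` every operator maps the source of an edge to its target, and the target to its
  negative. Following alternating words one sees that a component consists of two directed paths
  from a source to a sink, of lengths at most `n` (`Braid.exists_isBipath`).
* The sum of all vertices spans a copy of the trivial representation `T_s ↦ q`. By the braid
  relation the trivial representation is also a quotient. The corresponding functional is multiplied
  by `q` along a solid edge and by `u (u - 1) / (u + 1)` along a dashed one. At `u = 2`, comparing
  prime factors, one finds that both paths have the same length and the same number of dashed edges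
  (`IsBipath.eq_length_of_braid`).
* The recurrence is homogeneous if `c` and `u` are given degree `1`, so every eigenvalue of `c` is
  `± (q + 1)` or `u` times an algebraic integer. Hence the trace of `c²` is congruent to a multiple of
  `(q + 1)²` modulo `u²`. Comparison with the diagonal entries, for a large integer `u`, shows that
  no dashed edge lies in the interior of a path (`IsBipath.dashedStep_eq_false`).

This leaves exactly the eight families. Finally, the lengths of valid braid relations are closed
under subtraction, and all are at least `m`; hence the length `k < 2 m` found above divides all of
them (`dvd_of_altDiff_eq_zero`).
-/

/-! ### Alternating words -/

section AltWord

variable {A : Type*} [Ring A] (T : Bool → A)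

/-- The alternating product of `k` factors `T false`, `T true` whose rightmost factor is `T i`. -/
def altWord : Bool → ℕ → A
  | _, 0 => 1
  | i, k + 1 => altWord (!i) k * T i

/-- The difference of the two alternating products of `k` factors; it vanishes exactly when the
braid relation of length `k` holds. -/
def altDiff (k : ℕ) : A := altWord T false k - altWord T true k

@[simp] theorem altWord_zero (i : Bool) : altWord T i 0 = 1 := rfl

theorem altWord_succ (i : Bool) (k : ℕ) : altWord T i (k + 1) = altWord T (!i) k * T i := rfl

theorem altWord_one (i : Bool) : altWord T i 1 = T i := by simp [altWord_succ]

theorem altWord_succ' (i : Bool) (k : ℕ) :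
    altWord T i (k + 1) = T (i ^^ k.bodd) * altWord T i k := by
  induction k generalizing i with
  | zero => simp [altWord]
  | succ k ih =>
    rw [altWord_succ, ih, altWord_succ, mul_assoc]
    cases i <;> cases h : k.bodd <;> simp [h]

theorem altWord_add (i : Bool) (n k : ℕ) :
    altWord T i (n + k) = altWord T (i ^^ k.bodd) n * altWord T i k := by
  induction k generalizing i with
  | zero => simp
  | succ k ih =>
    rw [← add_assoc, altWord_succ, ih, altWord_succ, mul_assoc]
    cases i <;> cases h : k.bodd <;> simp [h]

theorem altProd_eq_altWord (i : Bool) (k : ℕ) :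
    altProd (T i) (T (!i)) k = altWord T (i ^^ !k.bodd) k := by
  induction k generalizing i with
  | zero => rfl
  | succ k ih =>
    have := ih (!i)
    rw [Bool.not_not] at this
    rw [altProd, this, altWord_succ']
    cases i <;> cases h : k.bodd <;> simp [h]

theorem altProd_eq_iff (k : ℕ) :
    altProd (T false) (T true) k = altProd (T true) (T false) k ↔ altDiff T k = 0 := by
  have h₁ := altProd_eq_altWord T false k
  have h₂ := altProd_eq_altWord T true k
  simp only [Bool.not_false, Bool.not_true] at h₁ h₂
  rw [h₁, h₂, altDiff, sub_eq_zero]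
  cases k.bodd <;> simp [eq_comm]

@[simp] theorem altDiff_zero : altDiff T 0 = 0 := by simp [altDiff]

theorem altDiff_one : altDiff T 1 = T false - T true := by simp [altDiff, altWord_one]

theorem altDiff_add {k : ℕ} (hk : altDiff T k = 0) (n : ℕ) :
    altDiff T (n + k) = altDiff T n * altWord T false k ∨
      altDiff T (n + k) = -(altDiff T n * altWord T false k) := by
  have h : altWord T true k = altWord T false k := (sub_eq_zero.mp hk).symm
  simp only [altDiff, altWord_add, h]
  cases k.bodd
  · left; simp [sub_mul]
  · right; simp [sub_mul]

theorem isUnit_altWord (hT : ∀ i, IsUnit (T i)) (i : Bool) (k : ℕ) : IsUnit (altWord T i k) := by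
  induction k generalizing i with
  | zero => exact isUnit_one
  | succ k ih => exact (ih _).mul (hT i)

theorem altDiff_add_eq_zero_iff (hT : ∀ i, IsUnit (T i)) {k : ℕ} (hk : altDiff T k = 0) (n : ℕ) :
    altDiff T (n + k) = 0 ↔ altDiff T n = 0 := by
  have hu := isUnit_altWord T hT false k
  rcases altDiff_add T hk n with h | h
  · rw [h, hu.mul_left_eq_zero]
  · rw [h, neg_eq_zero, hu.mul_left_eq_zero]

theorem altDiff_eq_zero_of_dvd {k n : ℕ} (hk : altDiff T k = 0) (h : k ∣ n) :
    altDiff T n = 0 := by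
  obtain ⟨j, rfl⟩ := h
  induction j with
  | zero => simp
  | succ j ih =>
    rcases altDiff_add T hk (k * j) with h | h <;> rw [Nat.mul_succ, h, ih] <;> simp

/-- The lengths of valid braid relations are closed under subtraction; so if all of them are at
least `m`, then a length less than `2 * m` divides every other one. -/
theorem dvd_of_altDiff_eq_zero (hT : ∀ i, IsUnit (T i)) {k m n : ℕ}
    (hm : ∀ r, 0 < r → altDiff T r = 0 → m ≤ r) (hk : altDiff T k = 0) (hk0 : 0 < k)
    (hkm : k < 2 * m) (hn : altDiff T n = 0) : k ∣ n := by
  have hr : altDiff T (n % k) = 0 := by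
    rw [← altDiff_add_eq_zero_iff T hT (altDiff_eq_zero_of_dvd T hk (dvd_mul_right k (n / k))),
      Nat.mod_add_div]
    exact hn
  have hlt := Nat.mod_lt n hk0
  by_contra hnd
  have hpos : 0 < n % k := Nat.pos_of_ne_zero fun h => hnd (Nat.dvd_of_mod_eq_zero h)
  have h1 := hm _ hpos hr
  have h2 : altDiff T (k - n % k) = 0 := by
    rw [← altDiff_add_eq_zero_iff T hT hr, Nat.sub_add_cancel hlt.le]
    exact hk
  have h3 := hm _ (by omega) h2
  omega

end AltWord

section Quadratic

variable {R A : Type*} [CommRing R] [Ring A] [Algebra R A] {T : Bool → A} {q : R}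

theorem altDiff_succ_succ (hT : ∀ i, T i * T i = (q - 1) • T i + q • 1) (k : ℕ) :
    altDiff T (k + 2) =
      (T false + T true - (q - 1) • 1) * altDiff T (k + 1) - q • altDiff T k := by
  have key : ∀ i, (T false + T true) * altWord T i (k + 1) =
      altWord T i (k + 2) + (q - 1) • altWord T i (k + 1) + q • altWord T i k := by
    intro i
    have h1 : altWord T i (k + 2) = T (!(i ^^ k.bodd)) * altWord T i (k + 1) := by
      rw [altWord_succ']; cases i <;> cases h : k.bodd <;> simp [h]
    have h2 : T (i ^^ k.bodd) * altWord T i (k + 1) =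
        (q - 1) • altWord T i (k + 1) + q • altWord T i k := by
      rw [altWord_succ' T i k, ← mul_assoc, hT, add_mul, smul_mul_assoc, smul_mul_assoc, one_mul]
    have h3 : T false + T true = T (!(i ^^ k.bodd)) + T (i ^^ k.bodd) := by
      cases (i ^^ k.bodd) <;> simp [add_comm]
    rw [h3, add_mul, h2, h1, add_assoc]
  have h0 := key false
  have h1 := key true
  rw [sub_mul, smul_one_mul, altDiff, altDiff, altDiff, mul_sub, h0, h1]
  module

/-- The operator `T_i` can be moved past `altDiff T k`; hence the kernel of `altDiff T k` is a
submodule for the Hecke algebra. -/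
theorem altDiff_mul (hT : ∀ i, T i * T i = (q - 1) • T i + q • 1) (i : Bool) (k : ℕ) :
    altDiff T k * T i = ((q - 1) • 1 - T (i ^^ k.bodd)) * altDiff T k := by
  have hc : ∀ i, (T false + T true - (q - 1) • 1) * T i =
      T (!i) * (T false + T true - (q - 1) • 1) := by
    intro i
    have h0 := hT false
    have h1 := hT true
    cases i <;> simp only [Bool.not_false, Bool.not_true, sub_mul, add_mul, mul_sub, mul_add, h0,
      h1, smul_one_mul, mul_smul_comm, mul_one] <;> abel
  induction k using Nat.twoStepInduction with
  | zero => simp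
  | one =>
    have h0 := hT false
    have h1 := hT true
    rw [altDiff_one]
    cases i <;> simp only [Nat.bodd_one, Bool.xor_true, Bool.not_false, Bool.not_true, sub_mul,
      mul_sub, h0, h1, smul_one_mul] <;> abel
  | more k ih0 ih1 =>
    have hb : (i ^^ (k + 1).bodd) = !(i ^^ k.bodd) := by
      cases i <;> cases h : k.bodd <;> simp [h]
    have hb2 : (i ^^ (k + 2).bodd) = (i ^^ k.bodd) := by
      simp
    rw [altDiff_succ_succ hT, sub_mul, smul_mul_assoc, ih0, mul_assoc, ih1, hb, hb2, ← mul_assoc,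
      mul_sub, hc, Bool.not_not, mul_smul_comm, mul_one]
    simp only [sub_mul, mul_sub, smul_mul_assoc, one_mul, mul_smul_comm, mul_assoc]
    simp only [smul_sub]
    abel

end Quadratic

section Reflection

variable {R E : Type*} [CommRing R] [AddCommGroup E] [Module R E]

/-- A solution of the Chebyshev recurrence with `e 0 = 0` which has a half-integral centre of
symmetry `m - 1/2` vanishes at `2 * m - 1`. -/
theorem eq_zero_of_reflection_half {e : ℕ → E} {c : Module.End R E} {q ρ : R} (hρ : ρ ^ 2 = q)
    (h0 : e 0 = 0) (he : ∀ k, e (k + 2) = c (e (k + 1)) - q • e k) {m : ℕ}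
    (hm : e (m + 1) = ρ • e m) : e (2 * m + 1) = 0 := by
  suffices h : ∀ i ≤ m, e (m + 1 + i) = (ρ * q ^ i) • e (m - i) by
    have := h m le_rfl
    rw [Nat.sub_self, h0, smul_zero] at this
    rwa [two_mul, add_assoc, add_comm m 1, ← add_assoc]
  intro i
  induction i using Nat.twoStepInduction with
  | zero => simp [hm]
  | one =>
    intro hi
    obtain ⟨m, rfl⟩ := Nat.exists_eq_add_of_le' hi
    have h1 : q • e m = c (e (m + 1)) - e (m + 2) := by rw [he]; abel
    rw [show m + 1 + 1 + 1 = (m + 1) + 2 from rfl, he, hm, map_smul, pow_one, mul_smul,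
      Nat.add_sub_cancel, h1, show m + 2 = m + 1 + 1 from rfl, hm, smul_sub, smul_smul, ← pow_two,
      hρ]
  | more i ih0 ih1 =>
    intro hi
    obtain ⟨j, rfl⟩ := Nat.exists_eq_add_of_le' hi
    have h0' := ih0 (by omega)
    have h1' := ih1 (by omega)
    rw [show j + (i + 2) - i = j + 2 by omega] at h0'
    rw [show j + (i + 2) - (i + 1) = j + 1 by omega] at h1'
    have h2 : q • e j = c (e (j + 1)) - e (j + 2) := by rw [he]; abel
    rw [show j + (i + 2) + 1 + (i + 2) = (j + (i + 2) + 1 + i) + 2 by omega, he,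
      show j + (i + 2) + 1 + i + 1 = j + (i + 2) + 1 + (i + 1) by omega, h0', h1',
      show j + (i + 2) - (i + 2) = j by omega, map_smul,
      show ρ * q ^ (i + 2) = (ρ * q ^ (i + 1)) * q by ring, mul_smul _ q, h2, smul_sub, smul_smul]
    congr 2
    ring

/-- A solution of the Chebyshev recurrence with `e 0 = 0` which has an integral centre of
symmetry `m` vanishes at `2 * m`. -/
theorem eq_zero_of_reflection {e : ℕ → E} {c : Module.End R E} {q : R}
    (h0 : e 0 = 0) (he : ∀ k, e (k + 2) = c (e (k + 1)) - q • e k) {m : ℕ}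
    (hm : e (m + 2) = q • e m) : e (2 * m + 2) = 0 := by
  suffices h : ∀ i ≤ m, e (m + 2 + i) = q ^ (i + 1) • e (m - i) by
    have := h m le_rfl
    rw [Nat.sub_self, h0, smul_zero] at this
    rwa [two_mul, add_assoc, add_comm m 2, ← add_assoc]
  intro i
  induction i using Nat.twoStepInduction with
  | zero => simp [hm]
  | one =>
    intro hi
    obtain ⟨m, rfl⟩ := Nat.exists_eq_add_of_le' hi
    have h1 : q • e m = c (e (m + 1)) - e (m + 2) := by rw [he]; abel
    rw [show m + 1 + 2 + 1 = (m + 2) + 2 from rfl, he, show m + 2 + 1 = m + 1 + 2 from rfl, hm,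
      map_smul, pow_succ, pow_one, mul_smul, Nat.add_sub_cancel, h1, smul_sub]
  | more i ih0 ih1 =>
    intro hi
    obtain ⟨j, rfl⟩ := Nat.exists_eq_add_of_le' hi
    have h0' := ih0 (by omega)
    have h1' := ih1 (by omega)
    rw [show j + (i + 2) - i = j + 2 by omega] at h0'
    rw [show j + (i + 2) - (i + 1) = j + 1 by omega] at h1'
    have h2 : q • e j = c (e (j + 1)) - e (j + 2) := by rw [he]; abel
    rw [show j + (i + 2) + 2 + (i + 2) = (j + (i + 2) + 2 + i) + 2 by omega, he,
      show j + (i + 2) + 2 + i + 1 = j + (i + 2) + 2 + (i + 1) by omega, h0', h1',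
      show j + (i + 2) - (i + 2) = j by omega, map_smul, pow_succ q (i + 2), mul_smul _ q, h2,
      smul_sub, smul_smul, ← pow_succ']

end Reflection

/-! ### Two-coloured graphs and their Hecke operators -/

/-- The part of an `S`-labeled digraph that is visible to two distinct labels, here called `false`
and `true`: `flip i v` is the other end of the edge with label `i` at `v`, and the Booleans `out i v`
and `dashed i v` tell whether that edge starts at `v` and whether it is dashed. -/
structure DihedralGraph (V : Type*) where
  flip : Bool → V → V
  out : Bool → V → Bool
  dashed : Bool → V → Bool
  flip_flip : ∀ i v, flip i (flip i v) = v
  flip_ne : ∀ i v, flip i v ≠ v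
  out_flip : ∀ i v, out i (flip i v) = !out i v
  dashed_flip : ∀ i v, dashed i (flip i v) = dashed i v

namespace DihedralGraph

variable {V V' R R' : Type*} (G : DihedralGraph V) (G' : DihedralGraph V')
variable [CommRing R] [CommRing R']

/-- Every nonempty set of vertices that is closed under passing along edges is everything. -/
def IsConnected : Prop :=
  ∀ A : Set V, A.Nonempty → (∀ i, ∀ v ∈ A, G.flip i v ∈ A) → A = Set.univ

/-- All edges at `v` start at `v`. -/
def IsSource (v : V) : Prop := ∀ i, G.out i v = true

/-- All edges at `v` end at `v`. -/
def IsSink (v : V) : Prop := ∀ i, G.out i v = false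

/-- The coefficient `C` with `(τ_i + 1) v = C • (v + flip i v)`, for the parameter `x` in place of
`u`. -/
def weight (x : R) (i : Bool) (v : V) : R :=
  if G.out i v then (if G.dashed i v then x + 1 else 1)
  else (if G.dashed i v then x ^ 2 - x else x ^ 2)

theorem weight_flip (x : R) (i : Bool) (v : V) :
    G.weight x i (G.flip i v) = x ^ 2 + 1 - G.weight x i v := by
  simp only [weight, out_flip, dashed_flip]
  cases G.out i v <;> cases G.dashed i v <;> (simp; try ring)

theorem map_weight (φ : R →+* R') (x : R) (i : Bool) (v : V) :
    φ (G.weight x i v) = G.weight (φ x) i v := by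
  simp only [weight]
  cases G.out i v <;> cases G.dashed i v <;> simp

/-- The operators `τ_i` over an arbitrary coefficient ring, for the parameter `x` in place
of `u`. -/
noncomputable def op (x : R) (i : Bool) : Module.End R (V →₀ R) :=
  Finsupp.linearCombination R fun v =>
    Finsupp.single v (G.weight x i v - 1) + Finsupp.single (G.flip i v) (G.weight x i v)

theorem op_single (x : R) (i : Bool) (v : V) (r : R) :
    G.op x i (Finsupp.single v r) =
      Finsupp.single v (r * (G.weight x i v - 1)) +
        Finsupp.single (G.flip i v) (r * G.weight x i v) := by
  simp only [op, Finsupp.linearCombination_single, smul_add, Finsupp.smul_single, smul_eq_mul]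

theorem op_mul_op (x : R) (i : Bool) :
    G.op x i * G.op x i = (x ^ 2 - 1) • G.op x i + x ^ 2 • 1 := by
  refine Finsupp.lhom_ext fun v r => ?_
  simp only [Module.End.mul_apply, op_single, map_add, LinearMap.add_apply, LinearMap.smul_apply,
    Module.End.one_apply, weight_flip, flip_flip, Finsupp.smul_single, smul_add, smul_eq_mul]
  classical
  ext w
  simp only [Finsupp.add_apply, Finsupp.single_apply]
  split_ifs <;> ring

/-- The braid relation with `n` factors on each side holds for the operators `τ_i`, with the
parameter `x` in place of `u`. -/
def Braid (x : R) (n : ℕ) : Prop := altDiff (G.op x) n = 0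

theorem Braid.altWord_eq {G : DihedralGraph V} {x : R} {n : ℕ} (h : G.Braid x n) (i j : Bool) :
    altWord (G.op x) i n = altWord (G.op x) j n := by
  have := sub_eq_zero.mp h
  cases i <;> cases j <;> first | rfl | exact this | exact this.symm

/-! ### Change of the parameter, and subgraphs -/

section BaseChange

variable (φ : R →+* R')

theorem mapRange_op (x : R) (i : Bool) (f : V →₀ R) :
    Finsupp.mapRange.addMonoidHom (φ : R →+ R') (G.op x i f) =
      G.op (φ x) i (Finsupp.mapRange.addMonoidHom (φ : R →+ R') f) := by
  induction f using Finsupp.induction_linear with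
  | zero => simp
  | add f g hf hg => simp only [map_add, hf, hg]
  | single v r =>
    simp only [op_single, map_add, Finsupp.mapRange.addMonoidHom_apply, Finsupp.mapRange_single,
      AddMonoidHom.coe_coe, map_mul, map_sub, map_one, map_weight]

theorem mapRange_altWord (x : R) (i : Bool) (k : ℕ) (f : V →₀ R) :
    Finsupp.mapRange.addMonoidHom (φ : R →+ R') (altWord (G.op x) i k f) =
      altWord (G.op (φ x)) i k (Finsupp.mapRange.addMonoidHom (φ : R →+ R') f) := by
  induction k generalizing i f with
  | zero => rfl
  | succ k ih => simp only [altWord_succ, Module.End.mul_apply, ih, mapRange_op]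

theorem mapRange_altDiff (x : R) (k : ℕ) (f : V →₀ R) :
    Finsupp.mapRange.addMonoidHom (φ : R →+ R') (altDiff (G.op x) k f) =
      altDiff (G.op (φ x)) k (Finsupp.mapRange.addMonoidHom (φ : R →+ R') f) := by
  simp only [altDiff, LinearMap.sub_apply, map_sub, mapRange_altWord]

variable {G}

theorem Braid.map {x : R} {n : ℕ} (h : G.Braid x n) : G.Braid (φ x) n := by
  refine Finsupp.lhom_ext' fun v => LinearMap.ext_ring ?_
  have := G.mapRange_altDiff φ x n (Finsupp.single v 1)
  rw [show altDiff (G.op x) n = 0 from h] at this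
  simpa using this.symm

theorem Braid.of_map (hφ : Function.Injective φ) {x : R} {n : ℕ} (h : G.Braid (φ x) n) :
    G.Braid x n := by
  refine LinearMap.ext fun f => ?_
  have := G.mapRange_altDiff φ x n f
  rw [show altDiff (G.op (φ x)) n = 0 from h, LinearMap.zero_apply] at this
  rw [LinearMap.zero_apply]
  refine (Finsupp.mapRange_injective φ (map_zero φ) hφ) ?_
  simpa using this

/-- All coefficients of the operators are integral polynomials in `u`, so a braid relation over
`ℚ(u)` may be specialized to any value of `u` in any commutative ring. -/
theorem Braid.specialize {n : ℕ} (h : G.Braid u n) (x : R) : G.Braid x n := by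
  let φ : Polynomial ℤ →+* Qu :=
    (algebraMap (Polynomial ℚ) Qu).comp (Polynomial.mapRingHom (Int.castRingHom ℚ))
  have hφ : Function.Injective φ :=
    (IsFractionRing.injective (Polynomial ℚ) Qu).comp
      (Polynomial.map_injective _ Int.cast_injective)
  have hX : φ Polynomial.X = u := by simp [φ, u]
  have h' : G.Braid (Polynomial.X : Polynomial ℤ) n := Braid.of_map φ hφ (hX ▸ h)
  have := h'.map (Polynomial.eval₂RingHom (Int.castRingHom R) x)
  simpa using this

end BaseChange

section Embedding

variable {G G'}

/-- `ι` identifies the two-coloured graph `G'` with a union of components of `G`. -/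
structure IsEmbedding (G' : DihedralGraph V') (G : DihedralGraph V) (ι : V' → V) : Prop where
  injective : Function.Injective ι
  flip : ∀ i v, ι (G'.flip i v) = G.flip i (ι v)
  out : ∀ i v, G'.out i v = G.out i (ι v)
  dashed : ∀ i v, G'.dashed i v = G.dashed i (ι v)

variable {ι : V' → V}

theorem IsEmbedding.weight (hι : IsEmbedding G' G ι) (x : R) (i : Bool) (v : V') :
    G'.weight x i v = G.weight x i (ι v) := by
  simp only [DihedralGraph.weight, hι.out, hι.dashed]

theorem IsEmbedding.map_op (hι : IsEmbedding G' G ι) (x : R) (i : Bool) (f : V' →₀ R) :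
    Finsupp.lmapDomain R R ι (G'.op x i f) = G.op x i (Finsupp.lmapDomain R R ι f) := by
  induction f using Finsupp.induction_linear with
  | zero => simp
  | add f g hf hg => simp only [map_add, hf, hg]
  | single v r =>
    simp only [op_single, map_add, Finsupp.lmapDomain_apply, Finsupp.mapDomain_single, hι.flip,
      hι.weight]

theorem IsEmbedding.map_altWord (hι : IsEmbedding G' G ι) (x : R) (i : Bool) (k : ℕ) (f : V' →₀ R) :
    Finsupp.lmapDomain R R ι (altWord (G'.op x) i k f) =
      altWord (G.op x) i k (Finsupp.lmapDomain R R ι f) := by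
  induction k generalizing i f with
  | zero => rfl
  | succ k ih => simp only [altWord_succ, Module.End.mul_apply, ih, hι.map_op]

theorem IsEmbedding.map_altDiff (hι : IsEmbedding G' G ι) (x : R) (k : ℕ) (f : V' →₀ R) :
    Finsupp.lmapDomain R R ι (altDiff (G'.op x) k f) =
      altDiff (G.op x) k (Finsupp.lmapDomain R R ι f) := by
  simp only [altDiff, LinearMap.sub_apply, map_sub, hι.map_altWord]

theorem Braid.of_isEmbedding (hι : IsEmbedding G' G ι) {x : R} {n : ℕ} (h : G.Braid x n) :
    G'.Braid x n := by
  refine LinearMap.ext fun f => Finsupp.mapDomain_injective hι.injective ?_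
  have := hι.map_altDiff x n f
  rw [show altDiff (G.op x) n = 0 from h] at this
  simpa using this

end Embedding

/-! ### Alternating walks -/

/-- The end of the walk of length `k` that starts at `v` along the edge labeled `i` and then uses
the two labels alternately. -/
def walk : Bool → ℕ → V → V
  | _, 0, v => v
  | i, k + 1, v => walk (!i) k (G.flip i v)

@[simp] theorem walk_zero (i : Bool) (v : V) : G.walk i 0 v = v := rfl

theorem walk_succ' (i : Bool) (k : ℕ) (v : V) :
    G.walk i (k + 1) v = G.walk (!i) k (G.flip i v) := rfl

theorem walk_succ (i : Bool) (k : ℕ) (v : V) :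
    G.walk i (k + 1) v = G.flip (i ^^ k.bodd) (G.walk i k v) := by
  induction k generalizing i v with
  | zero => simp [walk]
  | succ k ih =>
    rw [walk_succ', ih, walk_succ']
    cases i <;> cases h : k.bodd <;> simp [h]

theorem flip_walk_succ (i : Bool) (k : ℕ) (v : V) :
    G.flip (i ^^ k.bodd) (G.walk i (k + 1) v) = G.walk i k v := by
  rw [walk_succ, flip_flip]

theorem out_walk_succ (i : Bool) (k : ℕ) (v : V) :
    G.out (i ^^ k.bodd) (G.walk i (k + 1) v) = !G.out (i ^^ k.bodd) (G.walk i k v) := by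
  rw [walk_succ, out_flip]

/-- A walk can be traced back. -/
theorem walk_walk_add (i : Bool) (j k : ℕ) (v : V) :
    G.walk (i ^^ !(k + j).bodd) j (G.walk i (k + j) v) = G.walk i k v := by
  induction j with
  | zero => rfl
  | succ j ih =>
    rw [walk_succ', ← add_assoc, Nat.bodd_succ, Bool.not_not, flip_walk_succ,
      show (!(i ^^ (k + j).bodd)) = (i ^^ !(k + j).bodd) by
        cases i <;> cases (k + j).bodd <;> rfl]
    exact ih

end DihedralGraph

namespace DihedralGraph

/-! ### The specialization at zero: orientation of the components -/

section Zero

variable {V : Type*} {G : DihedralGraph V}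

theorem op_zero_of_out {i : Bool} {v : V} (h : G.out i v = true) (r : ℤ) :
    G.op 0 i (Finsupp.single v r) = Finsupp.single (G.flip i v) r := by
  rw [op_single]
  cases hd : G.dashed i v <;> simp [weight, h, hd]

theorem op_zero_of_in {i : Bool} {v : V} (h : G.out i v = false) (r : ℤ) :
    G.op 0 i (Finsupp.single v r) = Finsupp.single v (-r) := by
  rw [op_single]
  cases hd : G.dashed i v <;> simp [weight, h, hd]

theorem altWord_zero_of_out {i : Bool} {v : V} {k : ℕ}
    (h : ∀ j < k, G.out (i ^^ j.bodd) (G.walk i j v) = true) (r : ℤ) :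
    altWord (G.op (0 : ℤ)) i k (Finsupp.single v r) = Finsupp.single (G.walk i k v) r := by
  induction k with
  | zero => rfl
  | succ k ih =>
    rw [altWord_succ', Module.End.mul_apply, ih fun j hj => h j (by omega),
      op_zero_of_out (h k (by omega)), walk_succ]

theorem altWord_zero_of_isSink {v : V} (hv : G.IsSink v) (i : Bool) (k : ℕ) (r : ℤ) :
    altWord (G.op (0 : ℤ)) i k (Finsupp.single v r) = Finsupp.single v ((-1) ^ k * r) := by
  induction k with
  | zero => simp
  | succ k ih =>
    rw [altWord_succ', Module.End.mul_apply, ih, op_zero_of_in (hv _), pow_succ]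
    simp

/-- A walk that starts along an edge leaving its first vertex follows the direction of the edges
until it reaches a sink. -/
theorem out_walk_of_not_isSink {i : Bool} {v : V} (h0 : G.out i v = true) {k : ℕ}
    (hk : ∀ j < k, ¬ G.IsSink (G.walk i j v)) {j : ℕ} (hj : j < k) :
    G.out (i ^^ j.bodd) (G.walk i j v) = true := by
  induction j with
  | zero => simpa using h0
  | succ j ih =>
    have h1 : G.out (i ^^ j.bodd) (G.walk i (j + 1) v) = false := by
      rw [out_walk_succ, ih (by omega)]; rfl
    by_contra h2
    refine hk _ hj fun l => ?_
    rw [Bool.not_eq_true] at h2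
    have hb : (i ^^ (j + 1).bodd) = !(i ^^ j.bodd) := by
      cases i <;> cases h : j.bodd <;> simp [h]
    rw [hb] at h2
    cases hl : (i ^^ j.bodd) <;> rw [hl] at h1 h2 <;> cases l <;> assumption

/-- From a vertex with one incoming and one outgoing edge, the walk in the direction of the edges
reaches a sink in fewer than `n` steps: otherwise, at parameter `0`, the two alternating words
take the vertex to basis vectors with opposite signs. -/
theorem Braid.exists_isSink_of_in_out {n : ℕ} (hb : G.Braid (0 : ℤ) n) (hn : 0 < n) {i : Bool}
    {v : V} (hin : G.out (!i) v = false) (hout : G.out i v = true) :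
    ∃ j < n, G.IsSink (G.walk i j v) := by
  by_contra! h
  have hw : ∀ j < n, G.out (i ^^ j.bodd) (G.walk i j v) = true :=
    fun j hj => out_walk_of_not_isSink hout h hj
  obtain ⟨k, rfl⟩ := Nat.exists_eq_add_of_le' hn
  have h1 := altWord_zero_of_out hw 1
  have h2 : altWord (G.op (0 : ℤ)) (!i) (k + 1) (Finsupp.single v 1) =
      Finsupp.single (G.walk i k v) (-1) := by
    rw [altWord_succ, Module.End.mul_apply, op_zero_of_in hin, Bool.not_not,
      altWord_zero_of_out fun j hj => hw j (by omega)]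
  rw [hb.altWord_eq (!i) i, h1] at h2
  have h3 := DFunLike.congr_fun h2 (G.walk i (k + 1) v)
  classical
  rw [Finsupp.single_apply, Finsupp.single_apply, if_pos rfl] at h3
  split_ifs at h3
  omega

theorem Braid.exists_isSink_of_isSource {n : ℕ} (hb : G.Braid (0 : ℤ) n) (hn : 0 < n) {v : V}
    (hv : G.IsSource v) (i : Bool) : ∃ k ≤ n, G.IsSink (G.walk i k v) := by
  by_cases hs : G.IsSink (G.flip i v)
  · exact ⟨1, hn, hs⟩
  · have h1 : G.out i (G.flip i v) = false := by rw [out_flip, hv]; rfl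
    have h2 : G.out (!i) (G.flip i v) = true := by
      by_contra h2
      rw [Bool.not_eq_true] at h2
      exact hs fun l => by cases i <;> cases l <;> assumption
    obtain ⟨j, hj, hjs⟩ := hb.exists_isSink_of_in_out hn (by simpa using h1) h2
    exact ⟨j + 1, hj, hjs⟩

/-- Walking against the direction of the edges one reaches a source. -/
theorem Braid.exists_isSource {n : ℕ} (hb : G.Braid (0 : ℤ) n) (hn : 0 < n) [Nonempty V] :
    ∃ v, G.IsSource v := by
  by_contra! hns
  obtain ⟨v₀⟩ := ‹Nonempty V›
  -- some vertex is not a sink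
  obtain ⟨v, i, hv⟩ : ∃ v i, G.out i v = true := by
    cases h : G.out true v₀
    · exact ⟨G.flip true v₀, true, by rw [out_flip, h]; rfl⟩
    · exact ⟨v₀, true, h⟩
  have hv' : G.out (!i) v = false := by
    by_contra h
    rw [Bool.not_eq_false] at h
    exact hns v fun l => by cases i <;> cases l <;> assumption
  have hin : ∀ j, G.out (!i ^^ j.bodd) (G.walk (!i) j v) = false := by
    intro j
    induction j with
    | zero => simpa using hv'
    | succ j ih =>
      have h1 : G.out (!i ^^ j.bodd) (G.walk (!i) (j + 1) v) = true := by
        rw [out_walk_succ, ih]; rfl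
      by_contra h2
      rw [Bool.not_eq_false] at h2
      refine hns (G.walk (!i) (j + 1) v) fun l => ?_
      rw [Nat.bodd_succ] at h2
      revert h1 h2
      cases i <;> cases j.bodd <;> cases l <;> simp +contextual
  -- walking forward from a vertex `n` steps back returns to `v`
  obtain ⟨l, hl⟩ : ∃ l, l = (i ^^ n.bodd) := ⟨_, rfl⟩
  have hback : ∀ j ≤ n, G.walk l j (G.walk (!i) n v) = G.walk (!i) (n - j) v := by
    intro j hj
    have := G.walk_walk_add (!i) j (n - j) v
    rw [Nat.sub_add_cancel hj] at this
    rw [← this, hl]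
    cases i <;> cases n.bodd <;> rfl
  have h1 : G.out (!l) (G.walk (!i) n v) = false := by
    have := hin n
    rwa [hl, show (!(i ^^ n.bodd)) = (!i ^^ n.bodd) by cases i <;> cases n.bodd <;> rfl]
  have h2 : G.out l (G.walk (!i) n v) = true := by
    by_contra h
    rw [Bool.not_eq_true] at h
    obtain ⟨k, rfl⟩ := Nat.exists_eq_add_of_le' hn
    have h3 := hin k
    rw [← flip_walk_succ, out_flip, Bool.not_eq_false'] at h3
    rw [hl, show (i ^^ (k + 1).bodd) = (!i ^^ k.bodd) by
      rw [Nat.bodd_succ]; cases i <;> cases k.bodd <;> rfl] at h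
    rw [h] at h3
    cases h3
  obtain ⟨j, hj, hjs⟩ := hb.exists_isSink_of_in_out hn h1 h2
  rw [hback j hj.le, show n - j = n - j - 1 + 1 by omega] at hjs
  have h4 := hin (n - j - 1)
  rw [← flip_walk_succ, out_flip, hjs] at h4
  cases h4

/-- The walks from the source `v` that start along the edges labeled `false` and `true` follow the
direction of the edges, and meet in a sink after `a false` and `a true` steps. -/
structure IsBipath (G : DihedralGraph V) (v : V) (a : Bool → ℕ) : Prop where
  pos : ∀ i, 0 < a i
  out : ∀ i, ∀ j < a i, G.out (i ^^ j.bodd) (G.walk i j v) = true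
  meet : ∀ i i', G.walk i (a i) v = G.walk i' (a i') v
  isSink : ∀ i, G.IsSink (G.walk i (a i) v)

theorem IsBipath.isSource {v : V} {a : Bool → ℕ} (h : G.IsBipath v a) : G.IsSource v := by
  intro i
  simpa using h.out i 0 (h.pos i)

theorem Braid.exists_isBipath {n : ℕ} (hb : G.Braid (0 : ℤ) n) (hn : 0 < n) [Nonempty V] :
    ∃ v a, G.IsBipath v a := by
  classical
  obtain ⟨v, hv⟩ := hb.exists_isSource hn
  have hex : ∀ i, ∃ k, G.IsSink (G.walk i k v) := fun i =>
    (hb.exists_isSink_of_isSource hn hv i).imp fun _ h => h.2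
  have hle : ∀ i, Nat.find (hex i) ≤ n := fun i => by
    obtain ⟨k, hk, hks⟩ := hb.exists_isSink_of_isSource hn hv i
    exact (Nat.find_min' _ hks).trans hk
  have hout : ∀ i, ∀ j < Nat.find (hex i), G.out (i ^^ j.bodd) (G.walk i j v) = true :=
    fun i j hj => out_walk_of_not_isSink (hv i) (fun j hj => Nat.find_min (hex i) hj) hj
  have hw : ∀ i, altWord (G.op (0 : ℤ)) i n (Finsupp.single v 1) =
      Finsupp.single (G.walk i (Nat.find (hex i)) v) ((-1) ^ (n - Nat.find (hex i))) := by
    intro i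
    have h1 := Nat.sub_add_cancel (hle i)
    conv_lhs => rw [← h1]
    rw [altWord_add, Module.End.mul_apply, altWord_zero_of_out (hout i),
      altWord_zero_of_isSink (Nat.find_spec (hex i)), mul_one]
  refine ⟨v, fun i => Nat.find (hex i), ?_, hout, ?_, fun i => Nat.find_spec (hex i)⟩
  · intro i
    rw [Nat.pos_iff_ne_zero]
    intro h0
    have h1 := Nat.find_spec (hex i)
    rw [h0] at h1
    have := h1 i
    rw [walk_zero, hv] at this
    cases this
  · intro i i'
    have := hw i
    rw [hb.altWord_eq i i', hw i'] at this
    rcases Finsupp.single_eq_single_iff _ _ _ _ |>.mp this with h | h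
    · exact h.1.symm
    · exact absurd h.1 (pow_ne_zero _ (by norm_num))

/-- A braid relation cannot be shorter than the paths from the source to the sink. -/
theorem IsBipath.le_of_braid {v : V} {a : Bool → ℕ} (h : G.IsBipath v a) {n : ℕ} (hn : 0 < n)
    (hb : G.Braid (0 : ℤ) n) (i : Bool) : a i ≤ n := by
  obtain ⟨k, hk, hks⟩ := hb.exists_isSink_of_isSource hn h.isSource i
  by_contra! hlt
  have := h.out i k (by omega)
  rw [hks] at this
  cases this

end Zero

end DihedralGraph

/-! ### Scalar solutions of the Chebyshev recurrence -/

/-- The scalars by which the polynomials `e_k` with `e_0 = 0`, `e_1 = 1`,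
`e_{k+2} = X e_{k+1} - q e_k` act on an eigenvector with eigenvalue `l`. -/
def chebyshevSeq {R : Type*} [CommRing R] (q l : R) : ℕ → R
  | 0 => 0
  | 1 => 1
  | k + 2 => l * chebyshevSeq q l (k + 1) - q * chebyshevSeq q l k

section Chebyshev

variable {R : Type*} [CommRing R]

theorem chebyshevSeq_add_one_eq (q : R) (k : ℕ) :
    chebyshevSeq q (q + 1) (k + 1) = q * chebyshevSeq q (q + 1) k + 1 := by
  induction k with
  | zero => simp [chebyshevSeq]
  | succ k ih => rw [chebyshevSeq, ih]; ring

theorem chebyshevSeq_scale (x μ : R) (k : ℕ) :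
    x * chebyshevSeq (x ^ 2) (x * μ) k = x ^ k * chebyshevSeq 1 μ k := by
  induction k using Nat.twoStepInduction with
  | zero => simp [chebyshevSeq]
  | one => simp [chebyshevSeq]
  | more k h0 h1 =>
    simp only [chebyshevSeq]
    linear_combination x * μ * h1 - x ^ 2 * h0

theorem exists_monic_aeval_eq_chebyshevSeq (k : ℕ) :
    ∃ P : Polynomial ℤ, P.Monic ∧ P.natDegree = k ∧
      ∀ μ : R, Polynomial.aeval μ P = chebyshevSeq 1 μ (k + 1) := by
  induction k using Nat.twoStepInduction with
  | zero => exact ⟨1, Polynomial.monic_one, by simp, fun μ => by simp [chebyshevSeq]⟩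
  | one => exact ⟨Polynomial.X, Polynomial.monic_X, by simp, fun μ => by simp [chebyshevSeq]⟩
  | more k h0 h1 =>
    obtain ⟨P, hP, hPd, hPe⟩ := h0
    obtain ⟨Q, hQ, hQd, hQe⟩ := h1
    have hXQ : (Polynomial.X * Q).Monic := Polynomial.monic_X.mul hQ
    have hdeg : (Polynomial.X * Q).natDegree = k + 2 := by
      rw [Polynomial.natDegree_X_mul hQ.ne_zero, hQd]
    have hlt : P.degree < (Polynomial.X * Q).degree := by
      refine Polynomial.degree_lt_degree ?_
      omega
    refine ⟨Polynomial.X * Q - P, hXQ.sub_of_left hlt, ?_, fun μ => ?_⟩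
    · rw [Polynomial.natDegree_sub_eq_left_of_natDegree_lt (by omega), hdeg]
    · simp [hPe, hQe, chebyshevSeq]

theorem isIntegral_of_chebyshevSeq_eq_zero {μ : R} [Nontrivial R] {n : ℕ} (hn : 0 < n)
    (h : chebyshevSeq 1 μ n = 0) : IsIntegral ℤ μ := by
  obtain ⟨k, rfl⟩ := Nat.exists_eq_add_of_le' hn
  obtain ⟨P, hP, -, hPe⟩ := exists_monic_aeval_eq_chebyshevSeq (R := R) k
  exact ⟨P, hP, by rw [← Polynomial.aeval_def, hPe, h]⟩

end Chebyshev

section Quadratic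

variable {R A : Type*} [CommRing R] [Ring A] [Algebra R A] {T : Bool → A} {q : R}

theorem altDiff_one_mul_self (hT : ∀ i, T i * T i = (q - 1) • T i + q • 1) :
    altDiff T 1 * altDiff T 1 = (q + 1) ^ 2 • 1 -
      (T false + T true - (q - 1) • 1) * (T false + T true - (q - 1) • 1) := by
  have h0 := hT false
  have h1 := hT true
  rw [altDiff_one]
  simp only [sub_mul, mul_sub, add_mul, mul_add, h0, h1, smul_one_mul, mul_smul_comm, mul_one]
  module

end Quadratic

namespace DihedralGraph

variable {V R K : Type*} (G : DihedralGraph V) [CommRing R] [Field K]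

/-- The sum of the two operators, shifted so that it drives the recurrence
`altDiff_succ_succ`. -/
noncomputable def sumOp (x : R) : Module.End R (V →₀ R) :=
  G.op x false + G.op x true - (x ^ 2 - 1) • 1

theorem altDiff_op_succ_succ (x : R) (k : ℕ) :
    altDiff (G.op x) (k + 2) =
      G.sumOp x * altDiff (G.op x) (k + 1) - x ^ 2 • altDiff (G.op x) k :=
  altDiff_succ_succ (G.op_mul_op x) k

theorem altDiff_apply_succ_succ (x : R) (f : V →₀ R) (k : ℕ) :
    altDiff (G.op x) (k + 2) f =
      G.sumOp x (altDiff (G.op x) (k + 1) f) - x ^ 2 • altDiff (G.op x) k f := by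
  rw [altDiff_op_succ_succ]
  rfl

/-! ### The invariant functional -/

section Functional

variable [Fintype V]

theorem op_sum_single (x : R) (i : Bool) :
    G.op x i (∑ v, Finsupp.single v 1) = x ^ 2 • ∑ v, Finsupp.single v 1 := by
  simp only [map_sum, op_single, one_mul, Finset.sum_add_distrib]
  have : ∑ v, Finsupp.single (G.flip i v) (G.weight x i v) =
      ∑ v, Finsupp.single v (x ^ 2 + 1 - G.weight x i v) := by
    refine Finset.sum_equiv (Function.Involutive.toPerm _ (G.flip_flip i)) (by simp) fun v _ => ?_
    change _ = Finsupp.single (G.flip i v) (x ^ 2 + 1 - G.weight x i (G.flip i v))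
    rw [weight_flip, sub_sub_cancel]
  rw [this, ← Finset.sum_add_distrib, Finset.smul_sum]
  refine Finset.sum_congr rfl fun v _ => ?_
  rw [← Finsupp.single_add, Finsupp.smul_single]
  congr 1
  simp

/-- The sum of all vertices spans a trivial submodule. If a braid relation holds then the trivial
representation also occurs as a quotient. -/
theorem Braid.exists_functional [CharZero K] [Nonempty V] {G : DihedralGraph V} {x : K} {n : ℕ}
    (hb : G.Braid x n) (hx : chebyshevSeq (x ^ 2) (x ^ 2 + 1) n ≠ 0) :
    ∃ f : V → K, (∃ v, f v ≠ 0) ∧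
      ∀ i v, G.weight x i v * f (G.flip i v) = G.weight x i (G.flip i v) * f v := by
  set v₀ : V →₀ K := ∑ v, Finsupp.single v 1 with hv₀
  have hv₀0 : v₀ ≠ 0 := by
    intro h
    obtain ⟨w⟩ := ‹Nonempty V›
    have := DFunLike.congr_fun h w
    classical
    rw [hv₀, Finsupp.finsetSum_apply] at this
    simp [Finsupp.single_apply] at this
  have hc : (G.sumOp x - (x ^ 2 + 1) • (1 : Module.End K (V →₀ K))) v₀ = 0 := by
    simp only [sumOp, LinearMap.sub_apply, LinearMap.add_apply, LinearMap.smul_apply,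
      Module.End.one_apply]
    rw [hv₀, op_sum_single, op_sum_single]
    module
  have hlt : LinearMap.range (G.sumOp x - (x ^ 2 + 1) • (1 : Module.End K (V →₀ K))) < ⊤ := by
    rw [lt_top_iff_ne_top, Ne, LinearMap.range_eq_top, ← LinearMap.injective_iff_surjective]
    intro hinj
    exact hv₀0 (hinj (hc.trans (map_zero _).symm))
  obtain ⟨f, hf0, hf⟩ := Submodule.exists_le_ker_of_lt_top _ hlt
  have hfc : ∀ w, f (G.sumOp x w) = (x ^ 2 + 1) * f w := by
    intro w
    have h1 : f ((G.sumOp x - (x ^ 2 + 1) • (1 : Module.End K (V →₀ K))) w) = 0 := hf ⟨w, rfl⟩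
    simpa [sub_eq_zero] using h1
  have hE : ∀ k w, f (altDiff (G.op x) k w) =
      chebyshevSeq (x ^ 2) (x ^ 2 + 1) k * f (altDiff (G.op x) 1 w) := by
    intro k w
    induction k using Nat.twoStepInduction with
    | zero => simp [chebyshevSeq]
    | one => simp [chebyshevSeq]
    | more k h0 h1 =>
      rw [altDiff_op_succ_succ, LinearMap.sub_apply, map_sub, Module.End.mul_apply, hfc,
        LinearMap.smul_apply, map_smul, h0, h1, chebyshevSeq, smul_eq_mul]
      ring
  have h1 : ∀ w, f (G.op x false w) = f (G.op x true w) := by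
    intro w
    have := hE n w
    rw [show altDiff (G.op x) n = 0 from hb, LinearMap.zero_apply, map_zero, altDiff_one,
      LinearMap.sub_apply, map_sub] at this
    exact sub_eq_zero.mp ((mul_eq_zero.mp this.symm).resolve_left hx)
  have h2 : ∀ i w, f (G.op x i w) = x ^ 2 * f w := by
    intro i w
    have h3 := hfc w
    simp only [sumOp, LinearMap.sub_apply, LinearMap.add_apply, LinearMap.smul_apply,
      Module.End.one_apply, map_sub, map_add, map_smul, smul_eq_mul] at h3
    have h4 := h1 w
    have h5 : (2 : K) * (f (G.op x i w) - x ^ 2 * f w) = 0 := by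
      cases i
      · linear_combination h3 + h4
      · linear_combination h3 - h4
    exact sub_eq_zero.mp ((mul_eq_zero.mp h5).resolve_left two_ne_zero)
  refine ⟨fun v => f (Finsupp.single v 1), ?_, fun i v => ?_⟩
  · by_contra! h
    exact hf0 (Finsupp.lhom_ext' fun v => LinearMap.ext_ring (by simpa using h v))
  · have h3 := h2 i (Finsupp.single v 1)
    have h4 : ∀ w r, f (Finsupp.single w r) = r * f (Finsupp.single w 1) := by
      intro w r
      rw [← smul_eq_mul, ← map_smul, Finsupp.smul_single, smul_eq_mul, mul_one]
    rw [op_single, map_add, h4 v, h4 (G.flip i v), one_mul, one_mul] at h3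
    rw [weight_flip]
    linear_combination h3

end Functional

/-! ### The eigenvalues and the trace of `sumOp` -/

/-- An eigenvalue of `sumOp` is `± (x ^ 2 + 1)` or the product of `x` and an algebraic integer. -/
theorem Braid.eigenvalue_sumOp [CharZero K] {G : DihedralGraph V} {x : K} {n : ℕ}
    (hb : G.Braid x n) (hn : 0 < n) (hx : x ≠ 0) {l : K} {w : V →₀ K} (hw : w ≠ 0)
    (h : G.sumOp x w = l • w) :
    l ^ 2 = (x ^ 2 + 1) ^ 2 ∨ ∃ μ, IsIntegral ℤ μ ∧ l = x * μ := by
  have hE : ∀ k, altDiff (G.op x) k (altDiff (G.op x) 1 w) =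
      (chebyshevSeq (x ^ 2) l k * ((x ^ 2 + 1) ^ 2 - l ^ 2)) • w := by
    intro k
    induction k using Nat.twoStepInduction with
    | zero => simp [chebyshevSeq]
    | one =>
      rw [← Module.End.mul_apply, altDiff_one_mul_self (G.op_mul_op x), LinearMap.sub_apply]
      change _ - G.sumOp x (G.sumOp x w) = _
      rw [h, map_smul, h, LinearMap.smul_apply, Module.End.one_apply, chebyshevSeq]
      module
    | more k h0 h1 =>
      rw [altDiff_op_succ_succ, LinearMap.sub_apply, Module.End.mul_apply, h1, map_smul, h,
        LinearMap.smul_apply, h0, chebyshevSeq]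
      module
  have h1 := hE n
  rw [show altDiff (G.op x) n = 0 from hb, LinearMap.zero_apply] at h1
  rcases mul_eq_zero.mp ((smul_eq_zero.mp h1.symm).resolve_right hw) with h2 | h2
  · right
    refine ⟨l / x, ?_, by field_simp⟩
    refine isIntegral_of_chebyshevSeq_eq_zero hn ?_
    have h3 := chebyshevSeq_scale x (l / x) n
    rw [mul_div_cancel₀ _ hx, h2, mul_zero] at h3
    exact (mul_eq_zero.mp h3.symm).resolve_left (pow_ne_zero _ hx)
  · left
    exact (sub_eq_zero.mp h2).symm

theorem _root_.Multiset.exists_sum_eq {s : Multiset K} {a b : K}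
    (hs : ∀ ν ∈ s, ν = a ∨ ∃ κ, IsIntegral ℤ κ ∧ ν = b * κ) :
    ∃ c ≤ s.card, ∃ κ, IsIntegral ℤ κ ∧ s.sum = c * a + b * κ := by
  induction s using Multiset.induction with
  | empty => exact ⟨0, by simp, 0, isIntegral_zero, by simp⟩
  | cons ν s ih =>
    obtain ⟨c, hc, κ, hκ, hsum⟩ := ih fun ν' h => hs ν' (Multiset.mem_cons_of_mem h)
    rcases hs ν (Multiset.mem_cons_self ν s) with h | ⟨κ', hκ', h⟩
    · refine ⟨c + 1, by simpa using hc, κ, hκ, ?_⟩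
      rw [Multiset.sum_cons, hsum, h]
      push_cast
      ring
    · refine ⟨c, by rw [Multiset.card_cons]; omega, κ' + κ, hκ'.add hκ, ?_⟩
      rw [Multiset.sum_cons, hsum, h]
      ring

section Trace

variable [Fintype V]

theorem trace_eq_sum_apply_single (f : Module.End R (V →₀ R)) :
    LinearMap.trace R _ f = ∑ v, f (Finsupp.single v 1) v := by
  classical
  rw [LinearMap.trace_eq_matrix_trace R (Finsupp.basisSingleOne (R := R) (ι := V)), Matrix.trace]
  simp [LinearMap.toMatrix_apply]

theorem trace_sumOp_mul_self (hG : ∀ v, G.flip false v ≠ G.flip true v) (x : K) [CharZero K] :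
    LinearMap.trace K _ (G.sumOp x * G.sumOp x) =
      2 * ∑ v, G.weight x false v * G.weight x true v := by
  classical
  have hs : ∀ v r, G.sumOp x (Finsupp.single v r) =
      Finsupp.single v (r * (G.weight x false v + G.weight x true v - (x ^ 2 + 1))) +
      Finsupp.single (G.flip false v) (r * G.weight x false v) +
      Finsupp.single (G.flip true v) (r * G.weight x true v) := by
    intro v r
    simp only [sumOp, LinearMap.sub_apply, LinearMap.add_apply, LinearMap.smul_apply,
      Module.End.one_apply, op_single, Finsupp.smul_single, smul_eq_mul]
    ext w
    simp only [Finsupp.add_apply, Finsupp.sub_apply, Finsupp.single_apply]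
    split_ifs <;> ring
  have hd : ∀ v, (G.sumOp x * G.sumOp x) (Finsupp.single v 1) v =
      2 * (G.weight x false v * G.weight x true v) -
        (x ^ 2 + 1) * (G.weight x false v + G.weight x true v) + (x ^ 2 + 1) ^ 2 := by
    intro v
    have h1 : G.flip true (G.flip false v) ≠ v := fun h =>
      hG v (by rw [← G.flip_flip true (G.flip false v), h])
    have h2 : G.flip false (G.flip true v) ≠ v := fun h =>
      hG v (by rw [← G.flip_flip false (G.flip true v), h])
    rw [Module.End.mul_apply, hs, map_add, map_add, hs, hs, hs]
    simp only [Finsupp.add_apply, Finsupp.single_apply, flip_flip, G.flip_ne, h1, h2, if_true,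
      if_false, weight_flip]
    ring
  have hw : ∀ i, 2 * ∑ v, G.weight x i v = (Fintype.card V : K) * (x ^ 2 + 1) := by
    intro i
    have h1 : ∑ v, G.weight x i v = ∑ v, G.weight x i (G.flip i v) :=
      (Equiv.sum_comp (Function.Involutive.toPerm _ (G.flip_flip i)) (G.weight x i)).symm
    rw [two_mul]
    nth_rw 2 [h1]
    rw [← Finset.sum_add_distrib]
    simp [weight_flip, mul_add]
  rw [trace_eq_sum_apply_single, Finset.sum_congr rfl fun v _ => hd v]
  rw [Finset.sum_add_distrib, Finset.sum_sub_distrib, ← Finset.mul_sum, ← Finset.mul_sum,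
    Finset.sum_add_distrib]
  have h0 := hw false
  have h1 := hw true
  simp only [Finset.sum_const, Finset.card_univ, nsmul_eq_mul]
  have h2 : (2 : K) ≠ 0 := two_ne_zero
  refine mul_left_cancel₀ h2 ?_
  linear_combination -(x ^ 2 + 1) * (h0 + h1)

theorem Braid.exists_trace_eq {G : DihedralGraph V} {l : ℤ} {n : ℕ} (hb : G.Braid (l : ℂ) n)
    (hn : 0 < n) (hl : l ≠ 0) (hG : ∀ v, G.flip false v ≠ G.flip true v) :
    ∃ c : ℕ, c ≤ Fintype.card V ∧ ∃ z : ℤ,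
      2 * ∑ v, G.weight l false v * G.weight l true v = c * (l ^ 2 + 1) ^ 2 + l ^ 2 * z := by
  have hl' : (l : ℂ) ≠ 0 := Int.cast_ne_zero.mpr hl
  set c := G.sumOp (l : ℂ) with hc
  have hroots : ∀ ν ∈ (c * c).charpoly.roots,
      ν = ((l : ℂ) ^ 2 + 1) ^ 2 ∨ ∃ κ, IsIntegral ℤ κ ∧ ν = (l : ℂ) ^ 2 * κ := by
    intro ν hν
    have h1 : (c * c).HasEigenvalue ν :=
      (Module.End.hasEigenvalue_iff_isRoot_charpoly _ _).mpr (Polynomial.isRoot_of_mem_roots hν)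
    obtain ⟨w, hw⟩ := h1.exists_hasEigenvector
    have hw1 : c (c w) = ν • w := hw.apply_eq_smul
    obtain ⟨m, hm⟩ := IsAlgClosed.exists_pow_nat_eq ν two_pos
    obtain ⟨m', w', hw', hmw, hm'⟩ : ∃ m' w', w' ≠ 0 ∧ c w' = m' • w' ∧ m' ^ 2 = ν := by
      by_cases h2 : c w + m • w = 0
      · refine ⟨-m, w, hw.2, ?_, by rw [neg_sq, hm]⟩
        rw [neg_smul]
        exact eq_neg_of_add_eq_zero_left h2
      · refine ⟨m, _, h2, ?_, hm⟩
        rw [map_add, map_smul, hw1, ← hm]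
        module
    rcases hb.eigenvalue_sumOp hn hl' hw' hmw with h3 | ⟨μ, hμ, h3⟩
    · left; rw [← hm', h3]
    · right
      exact ⟨μ ^ 2, hμ.pow 2, by rw [← hm', h3]; ring⟩
  obtain ⟨a, ha, κ, hκ, hsum⟩ := Multiset.exists_sum_eq hroots
  have hcard : (c * c).charpoly.roots.card ≤ Fintype.card V := by
    refine (Polynomial.card_roots' _).trans ?_
    rw [LinearMap.charpoly_natDegree, Module.finrank_finsupp_self]
  rw [← Module.End.trace_eq_sum_roots_charpoly_of_splits (IsAlgClosed.splits _), hc,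
    G.trace_sumOp_mul_self hG] at hsum
  set s : ℤ := ∑ v, G.weight l false v * G.weight l true v with hs
  have hcast : ∑ v, G.weight (l : ℂ) false v * G.weight (l : ℂ) true v = (s : ℂ) := by
    rw [hs, Int.cast_sum]
    refine Finset.sum_congr rfl fun v _ => ?_
    have h1 := G.map_weight (Int.castRingHom ℂ) l
    simp only [eq_intCast] at h1
    rw [Int.cast_mul, h1, h1]
  rw [hcast] at hsum
  -- `κ` is rational and integral, hence an integer
  have hκ' : algebraMap ℚ ℂ ((2 * s - a * (l ^ 2 + 1) ^ 2) / l ^ 2) = κ := by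
    simp only [map_div₀, map_sub, map_mul, map_pow, map_add, map_natCast, map_intCast, map_one,
      map_ofNat]
    rw [div_eq_iff (pow_ne_zero _ hl'), hsum]
    ring
  rw [← hκ', isIntegral_algebraMap_iff (algebraMap ℚ ℂ).injective,
    IsIntegrallyClosed.isIntegral_iff] at hκ
  obtain ⟨z, hz⟩ := hκ
  refine ⟨a, ha.trans hcard, z, ?_⟩
  have h2 : (l : ℚ) ≠ 0 := Int.cast_ne_zero.mpr hl
  rw [eq_div_iff (pow_ne_zero _ h2)] at hz
  have h3 : ((2 * s : ℤ) : ℚ) = ((a * (l ^ 2 + 1) ^ 2 + l ^ 2 * z : ℤ) : ℚ) := by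
    push_cast
    simp only [eq_intCast] at hz
    linear_combination -hz
  exact_mod_cast h3

end Trace

end DihedralGraph

namespace DihedralGraph

/-! ### The shape of a component -/

theorem _root_.eq_of_four_pow_mul_six_pow {a b c d : ℕ} (h : 4 ^ a * 6 ^ d = 4 ^ b * 6 ^ c) :
    a = b ∧ c = d := by
  have key : ∀ {a b c d : ℕ}, c ≤ d → 4 ^ a * 6 ^ d = 4 ^ b * 6 ^ c → a = b ∧ c = d := by
    intro a b c d hcd h
    obtain ⟨e, rfl⟩ := Nat.exists_eq_add_of_le hcd
    have h1 : 4 ^ a * 6 ^ e = 4 ^ b := by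
      refine Nat.eq_of_mul_eq_mul_right (pow_pos (by norm_num : 0 < 6) c) ?_
      rw [← h, pow_add]
      ring
    rcases e with - | e
    · exact ⟨Nat.pow_right_injective (le_refl 4 |>.trans' (by norm_num)) (by simpa using h1), rfl⟩
    · have h2 : 3 ∣ 4 ^ b := by
        rw [← h1, pow_succ]
        exact Dvd.intro (4 ^ a * 6 ^ e * 2) (by ring)
      exact absurd (Nat.prime_three.dvd_of_dvd_pow h2) (by norm_num)
  rcases le_total c d with hcd | hcd
  · exact key hcd h
  · have := key hcd h.symm
    exact ⟨this.1.symm, this.2.symm⟩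

section Shape

variable {V : Type*} {G : DihedralGraph V}

/-- The type of the edge that the walk `G.walk i` from `v` uses in its step from position `j` to
position `j + 1`. -/
def dashedStep (G : DihedralGraph V) (v : V) (i : Bool) (j : ℕ) : Bool :=
  G.dashed (i ^^ j.bodd) (G.walk i j v)

theorem not_isSource_walk_succ {i : Bool} {j : ℕ} {v : V}
    (h : G.out (i ^^ j.bodd) (G.walk i j v) = true) : ¬ G.IsSource (G.walk i (j + 1) v) := by
  intro hs
  have := hs (i ^^ j.bodd)
  rw [out_walk_succ, h] at this
  cases this

theorem not_isSink_of_out {i : Bool} {v : V} (h : G.out i v = true) : ¬ G.IsSink v := by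
  intro hs
  rw [hs i] at h
  cases h

theorem eq_of_out_eq_false {v : V} (hv : ¬ G.IsSink v) {i i' : Bool} (h : G.out i v = false)
    (h' : G.out i' v = false) : i = i' := by
  by_contra hne
  refine hv fun l => ?_
  cases i <;> cases i' <;> cases l <;> first | assumption | exact absurd rfl hne

namespace IsBipath

variable {v : V} {a : Bool → ℕ}

theorem out_last (h : G.IsBipath v a) (i : Bool) {j : ℕ} (hj : j < a i) :
    G.out (i ^^ j.bodd) (G.walk i (j + 1) v) = false := by
  rw [out_walk_succ, h.out i j hj]
  rfl

theorem isSink_walk_iff (h : G.IsBipath v a) {i : Bool} {j : ℕ} (hj : j ≤ a i) :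
    G.IsSink (G.walk i j v) ↔ j = a i := by
  refine ⟨fun hs => ?_, fun hs => hs ▸ h.isSink i⟩
  by_contra hne
  exact not_isSink_of_out (h.out i j (by omega)) hs

theorem isSource_walk_iff (h : G.IsBipath v a) {i : Bool} {j : ℕ} (hj : j ≤ a i) :
    G.IsSource (G.walk i j v) ↔ j = 0 := by
  refine ⟨fun hs => ?_, fun hs => by rw [hs]; exact h.isSource⟩
  cases j with
  | zero => rfl
  | succ j => exact absurd hs (not_isSource_walk_succ (h.out i j (by omega)))

/-- The two paths have no common vertices besides their ends. -/
theorem walk_eq_walk (h : G.IsBipath v a) {i i' : Bool} {j j' : ℕ} (hj : j ≤ a i)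
    (hj' : j' ≤ a i') (heq : G.walk i j v = G.walk i' j' v) :
    (j = 0 ∧ j' = 0) ∨ (j = a i ∧ j' = a i') ∨ (i = i' ∧ j = j') := by
  induction j generalizing j' with
  | zero =>
    left
    refine ⟨rfl, ?_⟩
    rw [← h.isSource_walk_iff hj', ← heq]
    exact h.isSource
  | succ j ih =>
    cases j' with
    | zero =>
      have := (h.isSource_walk_iff hj).mp (heq ▸ h.isSource)
      omega
    | succ j' =>
      by_cases hs : j + 1 = a i
      · right; left
        refine ⟨hs, ?_⟩
        rw [← h.isSink_walk_iff hj', ← heq]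
        exact (h.isSink_walk_iff hj).mpr hs
      · have h1 := h.out_last i (j := j) (by omega)
        have h2 := h.out_last i' (j := j') (by omega)
        have hns : ¬ G.IsSink (G.walk i (j + 1) v) := fun h' =>
          hs ((h.isSink_walk_iff hj).mp h')
        have h3 := eq_of_out_eq_false hns h1 (heq ▸ h2)
        have h4 : G.walk i j v = G.walk i' j' v := by
          rw [← flip_walk_succ G i, ← flip_walk_succ G i', heq, h3]
        rcases ih (by omega) (by omega) h4 with ⟨rfl, rfl⟩ | h5 | ⟨rfl, rfl⟩
        · right; right
          exact ⟨by simpa using h3, rfl⟩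
        · omega
        · right; right
          exact ⟨rfl, rfl⟩

/-- The two edges that end in the sink have different labels. -/
theorem last_label_ne (h : G.IsBipath v a) {j j' : ℕ} (hj : j + 1 = a false)
    (hj' : j' + 1 = a true) : (false ^^ j.bodd) ≠ (true ^^ j'.bodd) := by
  intro heq
  have h1 : G.walk false j v = G.walk true j' v := by
    rw [← flip_walk_succ G false, ← flip_walk_succ G true, hj, hj', h.meet false true, heq]
  rcases h.walk_eq_walk (by omega) (by omega) h1 with ⟨rfl, rfl⟩ | h2 | h2
  · simp at heq
  · omega
  · exact absurd h2.1 (by simp)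

theorem exists_eq_walk (h : G.IsBipath v a) (hG : G.IsConnected) (w : V) :
    ∃ i j, j ≤ a i ∧ w = G.walk i j v := by
  suffices hA : {w | ∃ i j, j ≤ a i ∧ w = G.walk i j v} = Set.univ by
    have : w ∈ {w | ∃ i j, j ≤ a i ∧ w = G.walk i j v} := hA ▸ Set.mem_univ w
    exact this
  refine hG _ ⟨v, false, 0, Nat.zero_le _, rfl⟩ ?_
  rintro l _ ⟨i, j, hj, rfl⟩
  -- a step back along the path
  have hback : ∀ i j, j + 1 ≤ a i → l = (i ^^ j.bodd) →
      ∃ i' j', j' ≤ a i' ∧ G.flip l (G.walk i (j + 1) v) = G.walk i' j' v :=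
    fun i j hj hl => ⟨i, j, by omega, by rw [hl, flip_walk_succ]⟩
  rcases j with - | j
  · exact ⟨l, 1, h.pos l, rfl⟩
  by_cases hl : l = (i ^^ j.bodd)
  · exact hback i j hj hl
  by_cases hs : j + 1 = a i
  · obtain ⟨jf, hjf⟩ := Nat.exists_eq_add_of_le' (h.pos false)
    obtain ⟨jt, hjt⟩ := Nat.exists_eq_add_of_le' (h.pos true)
    have hne := h.last_label_ne hjf.symm hjt.symm
    have hl' : l = (false ^^ jf.bodd) ∨ l = (true ^^ jt.bodd) := by
      revert hne
      cases l <;> cases jf.bodd <;> cases jt.bodd <;> simp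
    rcases hl' with hl' | hl'
    · rw [Set.mem_ofPred_eq, hs, h.meet i false, hjf]
      exact hback false jf hjf.ge hl'
    · rw [Set.mem_ofPred_eq, hs, h.meet i true, hjt]
      exact hback true jt hjt.ge hl'
  · refine ⟨i, j + 2, by omega, ?_⟩
    rw [walk_succ G i (j + 1), Nat.bodd_succ]
    congr 1
    revert hl
    cases l <;> cases i <;> cases j.bodd <;> simp

theorem finite (h : G.IsBipath v a) (hG : G.IsConnected) : Finite V := by
  refine Finite.of_surjective
    (fun p : Σ i : Bool, Fin (a i + 1) => G.walk p.1 p.2 v) fun w => ?_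
  obtain ⟨i, j, hj, rfl⟩ := h.exists_eq_walk hG w
  exact ⟨⟨i, j, by omega⟩, rfl⟩

theorem eq_of_isSource (h : G.IsBipath v a) (hG : G.IsConnected) {w : V} (hw : G.IsSource w) :
    w = v := by
  obtain ⟨i, j, hj, rfl⟩ := h.exists_eq_walk hG w
  rw [(h.isSource_walk_iff hj).mp hw, walk_zero]

/-- The value of an invariant functional along the paths, for the parameter `2`: a solid edge
multiplies it by `4`, and a dashed edge by `2 / 3`. -/
theorem functional_walk (h : G.IsBipath v a) {f : V → ℚ}
    (hf : ∀ i v, G.weight 2 i v * f (G.flip i v) = G.weight 2 i (G.flip i v) * f v) {i : Bool}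
    {k : ℕ} (hk : k ≤ a i) :
    f (G.walk i k v) * 6 ^ (Nat.count (fun j => G.dashedStep v i j = true) k) = f v * 4 ^ k := by
  induction k with
  | zero => simp
  | succ k ih =>
    have h1 := hf (i ^^ k.bodd) (G.walk i k v)
    rw [← walk_succ] at h1
    have h2 := h.out i k (by omega)
    have h3 := h.out_last i (j := k) (by omega)
    have h4 : G.dashed (i ^^ k.bodd) (G.walk i (k + 1) v) = G.dashedStep v i k := by
      rw [walk_succ, dashed_flip, dashedStep]
    have h5 : G.dashed (i ^^ k.bodd) (G.walk i k v) = G.dashedStep v i k := rfl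
    simp only [weight, h2, h3, h4, h5] at h1
    have h6 := ih (by omega)
    rw [Nat.count_succ, pow_succ 4 k, ← mul_assoc, ← h6]
    cases hd : G.dashedStep v i k
    · simp only [hd] at h1 ⊢
      norm_num at h1 ⊢
      rw [h1]; ring
    · simp only [hd] at h1 ⊢
      norm_num at h1 ⊢
      rw [pow_succ]
      linear_combination (2 * 6 ^ (Nat.count (fun j => G.dashedStep v i j = true) k)) * h1

theorem eq_length_of_braid (h : G.IsBipath v a) (hG : G.IsConnected) {n : ℕ} (hn : 0 < n)
    (hb : G.Braid (2 : ℚ) n) :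
    a false = a true ∧
      Nat.count (fun j => G.dashedStep v false j = true) (a false) =
        Nat.count (fun j => G.dashedStep v true j = true) (a true) := by
  have := h.finite hG
  have := Fintype.ofFinite V
  have : Nonempty V := ⟨v⟩
  have hpos : ∀ k, 0 ≤ chebyshevSeq ((2 : ℚ) ^ 2) (2 ^ 2 + 1) k := by
    intro k
    induction k with
    | zero => simp [chebyshevSeq]
    | succ k ih => rw [chebyshevSeq_add_one_eq]; positivity
  have hne : chebyshevSeq ((2 : ℚ) ^ 2) (2 ^ 2 + 1) n ≠ 0 := by
    obtain ⟨k, rfl⟩ := Nat.exists_eq_add_of_le' hn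
    rw [chebyshevSeq_add_one_eq]
    have := hpos k
    positivity
  obtain ⟨f, ⟨w, hw⟩, hf⟩ := hb.exists_functional hne
  have hfv : f v ≠ 0 := by
    intro hfv
    have hA := hG {w | f w = 0} ⟨v, hfv⟩ fun i w hw => by
      have h1 := hf i w
      rw [show f w = 0 from hw, mul_zero] at h1
      refine (mul_eq_zero.mp h1).resolve_left ?_
      simp only [weight]
      split_ifs <;> norm_num
    have : w ∈ {w | f w = 0} := hA ▸ Set.mem_univ w
    exact hw this
  have h0 := h.functional_walk hf (i := false) le_rfl
  have h1 := h.functional_walk hf (i := true) le_rfl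
  rw [h.meet true false] at h1
  refine eq_of_four_pow_mul_six_pow ?_
  have h2 : f v * (4 ^ a false *
      6 ^ Nat.count (fun j => G.dashedStep v true j = true) (a true)) = f v * (4 ^ a true *
      6 ^ Nat.count (fun j => G.dashedStep v false j = true) (a false)) := by
    rw [← mul_assoc, ← mul_assoc, ← h0, ← h1]
    ring
  exact_mod_cast mul_left_cancel₀ hfv h2

end IsBipath

end Shape

end DihedralGraph

namespace DihedralGraph

/-! ### Dashed edges in the interior of a path -/

section Interior

variable {V : Type*} {G : DihedralGraph V}

/-- Modulo `l ^ 2`, the product of the two weights at a vertex only depends on the dashed edges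
that leave it, if it is a source, or enter it, if it has one incoming and one outgoing edge. -/
theorem sq_dvd_weight_mul_weight (G : DihedralGraph V) (l : ℤ) (w : V) [Decidable (G.IsSource w)]
    [Decidable (¬ G.IsSource w ∧ ¬ G.IsSink w ∧ ∃ i, G.out i w = false ∧ G.dashed i w = true)] :
    l ^ 2 ∣ G.weight l false w * G.weight l true w -
      ((if G.IsSource w then
          1 + l * ((G.dashed false w).toNat + (G.dashed true w).toNat) else 0) -
        if ¬ G.IsSource w ∧ ¬ G.IsSink w ∧ ∃ i, G.out i w = false ∧ G.dashed i w = true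
          then l else 0) := by
  simp only [IsSource, IsSink, weight, Bool.forall_bool, Bool.exists_bool]
  cases G.out false w <;> cases G.out true w <;> cases G.dashed false w <;>
    cases G.dashed true w <;> simp only [Bool.toNat_true, Bool.toNat_false, reduceCtorEq, if_true,
      if_false, and_true, and_false, not_true_eq_false, not_false_eq_true,
      or_true, or_false, and_self, or_self] <;>
    first
    | exact ⟨0, by push_cast; ring1⟩
    | exact ⟨1, by push_cast; ring1⟩
    | exact ⟨l, by push_cast; ring1⟩
    | exact ⟨l + 1, by push_cast; ring1⟩
    | exact ⟨l ^ 2, by push_cast; ring1⟩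
    | exact ⟨l ^ 2 - l, by push_cast; ring1⟩
    | exact ⟨l ^ 2 - 2 * l + 1, by push_cast; ring1⟩

namespace IsBipath

variable {v : V} {a : Bool → ℕ}

theorem flip_ne_flip (h : G.IsBipath v a) (hG : G.IsConnected) (ha : ∀ i, 2 ≤ a i) (w : V) :
    G.flip false w ≠ G.flip true w := by
  intro heq
  have hA := hG {w, G.flip false w} ⟨w, Or.inl rfl⟩ (by
    rintro i x (rfl | rfl)
    · cases i
      · exact Or.inr rfl
      · exact Or.inr heq.symm
    · cases i
      · exact Or.inl (G.flip_flip _ _)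
      · left
        rw [heq, flip_flip])
  have hv : G.flip false v = G.flip true v := by
    rcases (hA ▸ Set.mem_univ v : v ∈ ({w, G.flip false w} : Set V)) with hv | hv
    · rw [hv, heq]
    · rw [hv, flip_flip, heq, flip_flip]
  have h1 := h.out false 1 (ha false)
  change G.out true (G.flip false v) = true at h1
  rw [hv, out_flip, h.isSource] at h1
  cases h1

/-- If both paths have length at least `2`, then a dashed edge starts at the source or ends in the
sink. -/
theorem dashedStep_eq_false (h : G.IsBipath v a) (hG : G.IsConnected) (ha : ∀ i, 2 ≤ a i) {n : ℕ}
    (hn : 0 < n) (hb : ∀ l : ℤ, G.Braid (l : ℂ) n) {i : Bool} {j : ℕ} (hj : 0 < j)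
    (hja : j + 1 < a i) : G.dashedStep v i j = false := by
  classical
  have := h.finite hG
  have := Fintype.ofFinite V
  set N : Finset V := Finset.univ.filter fun w =>
    ¬ G.IsSource w ∧ ¬ G.IsSink w ∧ ∃ i, G.out i w = false ∧ G.dashed i w = true with hN
  set d : ℕ := (G.dashed false v).toNat + (G.dashed true v).toNat with hd
  set l : ℤ := 4 * Fintype.card V + 8 with hl
  obtain ⟨c, hc, z, hz⟩ := (hb l).exists_trace_eq hn (by omega) (h.flip_ne_flip hG ha)
  have hsum : l ^ 2 ∣ ∑ w, G.weight l false w * G.weight l true w - (1 + l * d - N.card * l) := by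
    have h1 := Finset.dvd_sum (s := Finset.univ) fun w _ => G.sq_dvd_weight_mul_weight l w
    rw [Finset.sum_sub_distrib, Finset.sum_sub_distrib, ← Finset.sum_filter, ← Finset.sum_filter,
      Finset.sum_const, ← hN, nsmul_eq_mul] at h1
    have h2 : Finset.univ.filter (fun w => G.IsSource w) = {v} := by
      ext w
      simp only [Finset.mem_filter, Finset.mem_univ, true_and, Finset.mem_singleton]
      exact ⟨h.eq_of_isSource hG, fun hw => hw ▸ h.isSource⟩
    rw [h2, Finset.sum_singleton] at h1
    exact_mod_cast h1
  have hNV : N.card ≤ Fintype.card V := Finset.card_le_univ N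
  have hd2 : d ≤ 2 := by
    rw [hd]
    cases G.dashed false v <;> cases G.dashed true v <;> simp
  obtain ⟨y, hy⟩ := hsum
  have hmain : (c : ℤ) - 2 + 2 * l * (N.card - d) =
      l ^ 2 * (2 * y - z - c * (l ^ 2 + 2)) := by
    linear_combination 2 * hy - hz
  have hc2 : (c : ℤ) - 2 = 0 := by
    refine Int.eq_zero_of_abs_lt_dvd (m := l)
      ⟨l * (2 * y - z - c * (l ^ 2 + 2)) - 2 * (N.card - d), by linear_combination hmain⟩ ?_
    rw [abs_lt]
    omega
  have hNd : 2 * ((N.card : ℤ) - d) = 0 := by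
    refine Int.eq_zero_of_abs_lt_dvd (m := l) ⟨2 * y - z - c * (l ^ 2 + 2), ?_⟩ ?_
    · refine mul_left_cancel₀ (show l ≠ 0 by omega) ?_
      linear_combination hmain - hc2
    · rw [abs_lt]
      omega
  -- the dashed edges that leave the source account for all elements of `N`
  set D : Finset V := (Finset.univ.filter fun i => G.dashed i v = true).image fun i => G.flip i v
    with hD
  have hDN : D ⊆ N := by
    intro w hw
    obtain ⟨i, hi, rfl⟩ := Finset.mem_image.mp hw
    have hi' := (Finset.mem_filter.mp hi).2
    have h1 : (1 : ℕ) ≤ a i := h.pos i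
    refine Finset.mem_filter.mpr ⟨Finset.mem_univ _, ?_, ?_, i, ?_, ?_⟩
    · exact fun hs => absurd ((h.isSource_walk_iff h1).mp hs) one_ne_zero
    · intro hs
      have := (h.isSink_walk_iff h1).mp hs
      have := ha i
      omega
    · rw [out_flip, h.isSource]; rfl
    · rw [dashed_flip, hi']
  have hDcard : D.card = d := by
    rw [hD, Finset.card_image_of_injOn, Finset.card_filter]
    · rw [Fintype.sum_bool, hd]
      cases G.dashed false v <;> cases G.dashed true v <;> rfl
    · intro i _ i' _ heq
      have := h.flip_ne_flip hG ha v
      cases i <;> cases i' <;> first | rfl | exact absurd heq this | exact absurd heq.symm this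
  have hDN' : D = N := Finset.eq_of_subset_of_card_le hDN (by omega)
  by_contra hdash
  rw [Bool.not_eq_false] at hdash
  have hw : G.walk i (j + 1) v ∈ N := by
    refine Finset.mem_filter.mpr ⟨Finset.mem_univ _, ?_, ?_, i ^^ j.bodd, ?_, ?_⟩
    · exact fun hs => absurd ((h.isSource_walk_iff hja.le).mp hs) (Nat.succ_ne_zero j)
    · exact fun hs => hja.ne ((h.isSink_walk_iff hja.le).mp hs)
    · exact h.out_last i (by omega)
    · rw [walk_succ, dashed_flip]
      exact hdash
  rw [← hDN', hD] at hw
  obtain ⟨i', -, hw⟩ := Finset.mem_image.mp hw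
  rcases h.walk_eq_walk (j := 1) (h.pos i') hja.le hw with h1 | h1 | h1 <;> omega

end IsBipath

end Interior

end DihedralGraph

theorem isUnit_of_quadratic {R A : Type*} [CommRing R] [Ring A] [Algebra R A] {a : A} {q : R}
    (hq : IsUnit q) (h : a * a = (q - 1) • a + q • 1) : IsUnit a := by
  obtain ⟨q, rfl⟩ := hq
  have h1 : a * a - ((q : R) - 1) • a = (q : R) • 1 := by rw [h]; abel
  have h2 : ((q⁻¹ : Rˣ) : R) * q = 1 := by simp
  refine ⟨⟨a, ((q⁻¹ : Rˣ) : R) • (a - ((q : R) - 1) • 1), ?_, ?_⟩, rfl⟩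
  · rw [mul_smul_comm, mul_sub, mul_smul_comm, mul_one, h1, smul_smul, h2, one_smul]
  · rw [smul_mul_assoc, sub_mul, smul_mul_assoc, one_mul, h1, smul_smul, h2, one_smul]

namespace DihedralGraph

theorem altDiff_op_mul_op {V R : Type*} [CommRing R] (G : DihedralGraph V) (x : R) (i : Bool)
    (k : ℕ) : altDiff (G.op x) k * G.op x i =
      ((x ^ 2 - 1) • 1 - G.op x (i ^^ k.bodd)) * altDiff (G.op x) k :=
  altDiff_mul (G.op_mul_op x) i k

theorem isUnit_op {V R : Type*} [CommRing R] (G : DihedralGraph V) {x : R} (hx : IsUnit x)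
    (i : Bool) : IsUnit (G.op x i) :=
  isUnit_of_quadratic (A := Module.End R (V →₀ R)) (hx.pow 2) (G.op_mul_op x i)

/-! ### Braid relations in the eight families -/

section Families

variable {V K : Type*} [Field K] {G : DihedralGraph V} (x : K)

theorem op_single_of_solid {i : Bool} {w : V} (ho : G.out i w = true) (hd : G.dashed i w = false) :
    G.op x i (Finsupp.single w 1) = Finsupp.single (G.flip i w) 1 := by
  simp [op_single, weight, ho, hd]

theorem op_single_of_dashed {i : Bool} {w : V} (ho : G.out i w = true)
    (hd : G.dashed i w = true) :
    G.op x i (Finsupp.single w 1) =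
      x • Finsupp.single w 1 + (x + 1) • Finsupp.single (G.flip i w) 1 := by
  simp [op_single, weight, ho, hd, Finsupp.smul_single]

theorem altWord_single_of_solid {i : Bool} {w : V} {k : ℕ}
    (ho : ∀ j < k, G.out (i ^^ j.bodd) (G.walk i j w) = true)
    (hd : ∀ j < k, G.dashedStep w i j = false) :
    altWord (G.op x) i k (Finsupp.single w 1) = Finsupp.single (G.walk i k w) 1 := by
  induction k with
  | zero => rfl
  | succ k ih =>
    rw [altWord_succ', Module.End.mul_apply, ih (fun j hj => ho j (by omega))
      fun j hj => hd j (by omega), op_single_of_solid x (ho k (by omega)) (hd k (by omega)),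
      walk_succ]

namespace IsBipath

variable {v : V} {a : Bool → ℕ} {x}

/-- The source generates the module of a connected graph, so a braid relation only has to be
checked there. -/
theorem braid_of_apply_source (h : G.IsBipath v a) (hG : G.IsConnected) (hx : x + 1 ≠ 0) {k : ℕ}
    (hk : altDiff (G.op x) k (Finsupp.single v 1) = 0) : G.Braid x k := by
  have hw : ∀ i j, j ≤ a i → altDiff (G.op x) k (Finsupp.single (G.walk i j v) 1) = 0 := by
    intro i j
    induction j with
    | zero => exact fun _ => hk
    | succ j ih =>
      intro hj
      have h1 := ih (by omega)
      have h2 := LinearMap.congr_fun (G.altDiff_op_mul_op x (i ^^ j.bodd) k)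
        (Finsupp.single (G.walk i j v) 1)
      rw [Module.End.mul_apply, Module.End.mul_apply, h1, map_zero] at h2
      have ho := h.out i j (by omega)
      rw [walk_succ]
      cases hd : G.dashed (i ^^ j.bodd) (G.walk i j v)
      · rwa [op_single_of_solid x ho hd] at h2
      · rw [op_single_of_dashed x ho hd, map_add, map_smul, map_smul, h1, smul_zero,
          zero_add] at h2
        exact (smul_eq_zero.mp h2).resolve_left hx
  refine Finsupp.lhom_ext' fun w => LinearMap.ext_ring ?_
  obtain ⟨i, j, hj, rfl⟩ := h.exists_eq_walk hG w
  exact hw i j hj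

/-- If the two edges at the source are of the same type and form a bigon, then the two operators
coincide. -/
theorem braid_of_bigon (h : G.IsBipath v fun _ => 1) (hG : G.IsConnected) (hx : x + 1 ≠ 0)
    (hd : G.dashedStep v false 0 = G.dashedStep v true 0) (n : ℕ) : G.Braid x n := by
  have h1 : G.Braid x 1 := by
    refine h.braid_of_apply_source hG hx ?_
    have hm : G.flip false v = G.flip true v := h.meet false true
    have hd' : G.dashed false v = G.dashed true v := hd
    rw [altDiff_one, LinearMap.sub_apply, op_single, op_single, hm]
    simp [weight, h.isSource _, hd']
  exact altDiff_eq_zero_of_dvd _ h1 (one_dvd n)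

end IsBipath

/-- The component of `v` is the `2 * m`-gon with source `v`; all edges are solid, except that the
Booleans `tl`, `tr` tell whether the two edges at the source are dashed, and `bl`, `br` whether the
two edges at the sink are. Used for `2 ≤ m` only. -/
structure IsPolygonAt (G : DihedralGraph V) (v : V) (m : ℕ) (tl tr bl br : Bool) : Prop where
  isBipath : G.IsBipath v fun _ => m
  dashedStep : ∀ i, ∀ j < m, G.dashedStep v i j =
    if j = 0 then (if i then tr else tl) else if j + 1 = m then (if i then br else bl) else false

namespace IsPolygonAt

variable {x} {v : V} {m : ℕ} {tl tr bl br : Bool}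

/-- The two words with `m + 2` factors, applied to the source of a `2 * (m + 2)`-gon, in terms of
shorter words and the sink. -/
theorem altWord_source (h : G.IsPolygonAt v (m + 2) tl tr bl br) (i : Bool) :
    altWord (G.op x) i (m + 2) (Finsupp.single v 1) =
      if (if i then tr else tl) then
        if (if i then br else bl) then
          x • altWord (G.op x) (!i) (m + 1) (Finsupp.single v 1) +
            x • (altWord (G.op x) i (m + 1) (Finsupp.single v 1) -
              x • altWord (G.op x) (!i) m (Finsupp.single v 1)) +
            (x + 1) ^ 2 • Finsupp.single (G.walk false (m + 2) v) 1
        else x • altWord (G.op x) (!i) (m + 1) (Finsupp.single v 1) +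
          (x + 1) • Finsupp.single (G.walk false (m + 2) v) 1
      else
        if (if i then br else bl) then
          x • altWord (G.op x) i (m + 1) (Finsupp.single v 1) +
            (x + 1) • Finsupp.single (G.walk false (m + 2) v) 1
        else Finsupp.single (G.walk false (m + 2) v) 1 := by
  rw [h.isBipath.meet false i]
  have hout := h.isBipath.out i
  have hd0 : G.dashedStep v i 0 = if i then tr else tl := by
    rw [h.dashedStep i 0 (by omega), if_pos rfl]
  have hd1 : G.dashedStep v i (m + 1) = if i then br else bl := by
    rw [h.dashedStep i (m + 1) (by omega), if_neg (by omega), if_pos rfl]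
  have hdm : ∀ j, 0 < j → j < m + 1 → G.dashedStep v i j = false := fun j h1 h2 => by
    rw [h.dashedStep i j (by omega), if_neg (by omega), if_neg (by omega)]
  -- the last step
  have hlast : G.op x (i ^^ (m + 1).bodd) (Finsupp.single (G.walk i (m + 1) v) 1) =
      if (if i then br else bl) then x • Finsupp.single (G.walk i (m + 1) v) 1 +
        (x + 1) • Finsupp.single (G.walk i (m + 2) v) 1
      else Finsupp.single (G.walk i (m + 2) v) 1 := by
    rw [walk_succ G i (m + 1)]
    cases hb : (if i then br else bl)
    · rw [hb] at hd1
      exact op_single_of_solid x (hout _ (by omega)) hd1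
    · rw [hb] at hd1
      exact op_single_of_dashed x (hout _ (by omega)) hd1
  cases ht : (if i then tr else tl)
  · rw [ht] at hd0
    have h1 : altWord (G.op x) i (m + 1) (Finsupp.single v 1) =
        Finsupp.single (G.walk i (m + 1) v) 1 := by
      refine altWord_single_of_solid x (fun j hj => hout j (by omega)) fun j hj => ?_
      rcases Nat.eq_zero_or_pos j with rfl | hj0
      · exact hd0
      · exact hdm j hj0 hj
    rw [altWord_succ', Module.End.mul_apply, h1, hlast]
    cases (if i then br else bl) <;> rfl
  · rw [ht] at hd0
    have h2 : altWord (G.op x) (!i) m (Finsupp.single (G.flip i v) 1) =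
        Finsupp.single (G.walk i (m + 1) v) 1 := by
      have hb : ∀ j, (!i ^^ j.bodd) = (i ^^ (j + 1).bodd) := fun j => by
        rw [Nat.bodd_succ]; cases i <;> cases j.bodd <;> rfl
      refine altWord_single_of_solid x (fun j hj => ?_) fun j hj => ?_
      · rw [hb]
        exact hout (j + 1) (by omega)
      · have := hdm (j + 1) (by omega) (by omega)
        rw [DihedralGraph.dashedStep] at this ⊢
        rw [hb]
        exact this
    have h3 : ∀ k, altWord (G.op x) i (k + 1) (Finsupp.single v 1) =
        x • altWord (G.op x) (!i) k (Finsupp.single v 1) +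
          (x + 1) • altWord (G.op x) (!i) k (Finsupp.single (G.flip i v) 1) := by
      intro k
      have ho := hout 0 (by omega)
      rw [altWord_succ, Module.End.mul_apply]
      simp only [Nat.bodd_zero, Bool.xor_false, walk_zero] at ho
      simp only [DihedralGraph.dashedStep, Nat.bodd_zero, Bool.xor_false, walk_zero] at hd0
      rw [op_single_of_dashed x ho hd0, map_add, map_smul, map_smul]
    have h4 : altWord (G.op x) (!i) (m + 1) (Finsupp.single (G.flip i v) 1) =
        G.op x (i ^^ (m + 1).bodd) (Finsupp.single (G.walk i (m + 1) v) 1) := by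
      rw [altWord_succ', Module.End.mul_apply, h2, Nat.bodd_succ]
      congr 1
      cases i <;> cases m.bodd <;> rfl
    rw [h3 (m + 1), h4, hlast, h3 m, h2]
    cases (if i then br else bl)
    · simp
    · simp only [if_true]
      module

theorem braid_of_add_eq (h : G.IsPolygonAt v m tl tr bl br) (hm : 2 ≤ m) (hG : G.IsConnected)
    (hx : x + 1 ≠ 0)
    (hp : (tl, tr, bl, br) = (false, false, false, false) ∨
      (tl, tr, bl, br) = (true, false, false, true) ∨
      (tl, tr, bl, br) = (false, true, true, false)) : G.Braid x m := by
  refine h.isBipath.braid_of_apply_source hG hx ?_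
  obtain ⟨m, rfl⟩ := Nat.exists_eq_add_of_le' hm
  have h0 := h.altWord_source (x := x) false
  have h1 := h.altWord_source (x := x) true
  rw [altDiff, LinearMap.sub_apply, h0, h1]
  rcases hp with hp | hp | hp <;> cases hp <;> simp

theorem braid_two_mul_sub_one (h : G.IsPolygonAt v m tl tr bl br) (hm : 2 ≤ m)
    (hG : G.IsConnected) (hx : x + 1 ≠ 0)
    (hp : (tl, tr, bl, br) = (true, true, false, false) ∨
      (tl, tr, bl, br) = (false, false, true, true)) : G.Braid x (2 * m - 1) := by
  refine h.isBipath.braid_of_apply_source hG hx ?_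
  obtain ⟨m, rfl⟩ := Nat.exists_eq_add_of_le' hm
  have h0 := h.altWord_source (x := x) false
  have h1 := h.altWord_source (x := x) true
  have key : ∃ ρ : K, ρ ^ 2 = x ^ 2 ∧ altDiff (G.op x) (m + 1 + 1) (Finsupp.single v 1) =
      ρ • altDiff (G.op x) (m + 1) (Finsupp.single v 1) := by
    rcases hp with hp | hp <;> cases hp
    · refine ⟨-x, neg_sq x, ?_⟩
      rw [altDiff, LinearMap.sub_apply, h0, h1, altDiff, LinearMap.sub_apply]
      simp only [if_true, if_false, ite_self, Bool.not_false, Bool.not_true, reduceCtorEq]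
      module
    · refine ⟨x, rfl, ?_⟩
      rw [altDiff, LinearMap.sub_apply, h0, h1, altDiff, LinearMap.sub_apply]
      simp only [if_true, if_false, ite_self, Bool.not_false, Bool.not_true, reduceCtorEq]
      module
  obtain ⟨ρ, hρ, hk⟩ := key
  exact eq_zero_of_reflection_half (e := fun k => altDiff (G.op x) k (Finsupp.single v 1)) hρ
    (by simp) (G.altDiff_apply_succ_succ x _) hk

theorem braid_two_mul_sub_two (h : G.IsPolygonAt v m true true true true) (hm : 2 ≤ m)
    (hG : G.IsConnected) (hx : x + 1 ≠ 0) : G.Braid x (2 * m - 2) := by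
  refine h.isBipath.braid_of_apply_source hG hx ?_
  obtain ⟨m, rfl⟩ := Nat.exists_eq_add_of_le' hm
  have h0 := h.altWord_source (x := x) false
  have h1 := h.altWord_source (x := x) true
  have hk : altDiff (G.op x) (m + 2) (Finsupp.single v 1) =
      x ^ 2 • altDiff (G.op x) m (Finsupp.single v 1) := by
    rw [altDiff, LinearMap.sub_apply, h0, h1, altDiff, LinearMap.sub_apply]
    simp only [if_true, ite_self, Bool.not_false, Bool.not_true]
    module
  exact eq_zero_of_reflection (e := fun k => altDiff (G.op x) k (Finsupp.single v 1))
    (by simp) (G.altDiff_apply_succ_succ x _) hk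

end IsPolygonAt

end Families

/-! ### Classification of the connected two-coloured graphs with a braid relation -/

section Classification

variable {V : Type*} {G : DihedralGraph V}

theorem u_ne_zero : u ≠ 0 := RatFunc.X_ne_zero

theorem u_add_one_ne_zero : u + 1 ≠ 0 := by
  have h : algebraMap (Polynomial ℚ) Qu (Polynomial.X + Polynomial.C 1) ≠ 0 := by
    rw [Ne, FaithfulSMul.algebraMap_eq_zero_iff]
    exact Polynomial.X_add_C_ne_zero 1
  simpa [u] using h

theorem IsBipath.dvd_of_braid {v : V} {m : ℕ} (h : G.IsBipath v fun _ => m) {k n : ℕ}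
    (hk : G.Braid u k) (hk0 : 0 < k) (hkm : k < 2 * m) (hn : G.Braid u n) : k ∣ n :=
  dvd_of_altDiff_eq_zero _ (G.isUnit_op u_ne_zero.isUnit)
    (fun _ hr hb => h.le_of_braid hr (Braid.specialize hb 0) false) hk hk0 hkm hn

/-- `G` is one of the two-coloured graphs that correspond to the eight families, where `n` satisfies
the divisibility condition. -/
def IsAdmissible (G : DihedralGraph V) (n : ℕ) : Prop :=
  (∃ v m, 2 ≤ m ∧ m ∣ n ∧ (G.IsPolygonAt v m false false false false ∨
    G.IsPolygonAt v m true false false true ∨ G.IsPolygonAt v m false true true false)) ∨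
  (∃ v m, 2 ≤ m ∧ 2 * m - 1 ∣ n ∧
    (G.IsPolygonAt v m true true false false ∨ G.IsPolygonAt v m false false true true)) ∨
  (∃ v m, 2 ≤ m ∧ 2 * m - 2 ∣ n ∧ G.IsPolygonAt v m true true true true) ∨
  ∃ v, (G.IsBipath v fun _ => 1) ∧ G.dashedStep v false 0 = G.dashedStep v true 0

theorem IsAdmissible.braid {n : ℕ} (h : G.IsAdmissible n) (hG : G.IsConnected) :
    G.Braid u n := by
  have hu := u_add_one_ne_zero
  rcases h with ⟨v, m, hm, hmn, h | h | h⟩ | ⟨v, m, hm, hmn, h | h⟩ | ⟨v, m, hm, hmn, h⟩ |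
    ⟨v, h, hd⟩
  · exact altDiff_eq_zero_of_dvd _ (h.braid_of_add_eq hm hG hu (by simp)) hmn
  · exact altDiff_eq_zero_of_dvd _ (h.braid_of_add_eq hm hG hu (by simp)) hmn
  · exact altDiff_eq_zero_of_dvd _ (h.braid_of_add_eq hm hG hu (by simp)) hmn
  · exact altDiff_eq_zero_of_dvd _ (h.braid_two_mul_sub_one hm hG hu (by simp)) hmn
  · exact altDiff_eq_zero_of_dvd _ (h.braid_two_mul_sub_one hm hG hu (by simp)) hmn
  · exact altDiff_eq_zero_of_dvd _ (h.braid_two_mul_sub_two hm hG hu) hmn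
  · exact h.braid_of_bigon hG hu hd n

theorem count_eq_toNat_add_toNat {p : ℕ → Bool} {m : ℕ}
    (hp : ∀ j, 0 < j → j + 1 < m + 2 → p j = false) :
    Nat.count (fun j => p j = true) (m + 2) = (p 0).toNat + (p (m + 1)).toNat := by
  have h : ∀ k ≤ m, Nat.count (fun j => p j = true) (k + 1) = (p 0).toNat := by
    intro k
    induction k with
    | zero => intro _; cases h : p 0 <;> simp [Nat.count_succ, h]
    | succ k ih =>
      intro hk
      rw [Nat.count_succ, ih (by omega), hp (k + 1) (by omega) (by omega)]
      rfl
  rw [Nat.count_succ, h m le_rfl]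
  cases p (m + 1) <;> rfl

theorem Braid.isAdmissible {n : ℕ} (hb : G.Braid u n) (hn : 0 < n) (hG : G.IsConnected)
    [Nonempty V] : G.IsAdmissible n := by
  have hu := u_add_one_ne_zero
  obtain ⟨v, a, h⟩ := (hb.specialize 0).exists_isBipath hn
  obtain ⟨ha, hc⟩ := h.eq_length_of_braid hG hn (hb.specialize 2)
  obtain ⟨m, rfl⟩ : ∃ m, a = fun _ => m := ⟨a false, funext fun i => by
    cases i
    · rfl
    · exact ha.symm⟩
  have hm0 : 0 < m := h.pos false
  rcases Nat.lt_or_ge m 2 with hm | hm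
  · obtain rfl : m = 1 := by omega
    refine Or.inr (Or.inr (Or.inr ⟨v, h, ?_⟩))
    simp only [Nat.count_succ, Nat.count_zero] at hc
    cases h0 : G.dashedStep v false 0 <;> cases h1 : G.dashedStep v true 0 <;> simp [h0, h1] at hc ⊢
  obtain ⟨m, rfl⟩ := Nat.exists_eq_add_of_le' hm
  have hint : ∀ i j, 0 < j → j + 1 < m + 2 → G.dashedStep v i j = false := fun i j h1 h2 =>
    h.dashedStep_eq_false hG (fun _ => hm) hn (fun l => hb.specialize (l : ℂ)) h1 h2
  rw [count_eq_toNat_add_toNat (hint false), count_eq_toNat_add_toNat (hint true)] at hc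
  have hpoly : G.IsPolygonAt v (m + 2) (G.dashedStep v false 0) (G.dashedStep v true 0)
      (G.dashedStep v false (m + 1)) (G.dashedStep v true (m + 1)) := by
    refine ⟨h, fun i j hj => ?_⟩
    split_ifs with h1 h2 h3 h4
    · rw [h1, h2]
    · rw [h1, Bool.eq_false_of_not_eq_true h2]
    · rw [h4, show j = m + 1 by omega]
    · rw [Bool.eq_false_of_not_eq_true h4, show j = m + 1 by omega]
    · exact hint i j (by omega) (by omega)
  revert hc hpoly
  generalize G.dashedStep v false 0 = tl
  generalize G.dashedStep v true 0 = tr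
  generalize G.dashedStep v false (m + 1) = bl
  generalize G.dashedStep v true (m + 1) = br
  intro hc hpoly
  have c1 : G.Braid u (m + 2) → m + 2 ∣ n := fun hk =>
    h.dvd_of_braid hk (by omega) (by omega) hb
  have c2 : G.Braid u (2 * (m + 2) - 1) → 2 * (m + 2) - 1 ∣ n := fun hk =>
    h.dvd_of_braid hk (by omega) (by omega) hb
  have c3 : G.Braid u (2 * (m + 2) - 2) → 2 * (m + 2) - 2 ∣ n := fun hk =>
    h.dvd_of_braid hk (by omega) (by omega) hb
  -- the equation `hc` leaves the six families
  cases tl <;> cases tr <;> cases bl <;> cases br <;>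
    first
    | (exfalso; revert hc; decide)
    | exact Or.inl ⟨v, m + 2, hm, c1 (hpoly.braid_of_add_eq hm hG hu (by simp)),
        by simp only [hpoly, true_or, or_true]⟩
    | exact Or.inr (Or.inl ⟨v, m + 2, hm, c2 (hpoly.braid_two_mul_sub_one hm hG hu (by simp)),
        by simp only [hpoly, true_or, or_true]⟩)
    | exact Or.inr (Or.inr (Or.inl ⟨v, m + 2, hm, c3 (hpoly.braid_two_mul_sub_two hm hG hu),
        hpoly⟩))

end Classification

end DihedralGraph

/-! ### The polygons in terms of their two paths -/

namespace PolygonVertex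

/-- The `j`-th vertex of the left path (for `i = false`) or the right path (for `i = true`) from
`α_0` to `β_m`. The value for `m < j` does not matter. -/
def path (m : ℕ) (hm : 0 < m) (i : Bool) (j : ℕ) : PolygonVertex m :=
  if h0 : j = 0 then alpha 0 hm
  else if h : i = false ∧ j < m then alpha j h.2
  else if h' : j ≤ m then beta j (Nat.pos_of_ne_zero h0) h'
  else alpha 0 hm

variable {m : ℕ} {hm : 0 < m}

theorem path_zero (i : Bool) : path m hm i 0 = alpha 0 hm := by simp [path]

theorem path_false {j : ℕ} (hj : j < m) : path m hm false j = alpha j hj := by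
  by_cases h0 : j = 0
  · subst h0; exact path_zero _
  · simp [path, h0, hj]

theorem path_true {j : ℕ} (h0 : 1 ≤ j) (hj : j ≤ m) : path m hm true j = beta j h0 hj := by
  simp [path, hj, Nat.ne_of_gt h0]

theorem path_last (i : Bool) : path m hm i m = beta m hm le_rfl := by
  simp [path, hm.ne']

theorem exists_eq_path (hm : 0 < m) (p : PolygonVertex m) : ∃ i j, j ≤ m ∧ p = path m hm i j := by
  cases p with
  | alpha j h => exact ⟨false, j, h.le, (path_false h).symm⟩
  | beta j h₁ h₂ => exact ⟨true, j, h₂, (path_true h₁ h₂).symm⟩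

end PolygonVertex

section PathGraph

variable {S V : Type*}

/-- The labels `s`, `t`, indexed by the Booleans. -/
def pairLabel (s t : S) (i : Bool) : S := if i then t else s

theorem pairLabel_injective {s t : S} (hst : s ≠ t) : Function.Injective (pairLabel s t) := by
  intro i i' h
  cases i <;> cases i' <;> first | rfl | exact absurd h hst | exact absurd h.symm hst

theorem pairLabel_mem (s t : S) (i : Bool) : pairLabel s t i ∈ ({s, t} : Set S) := by
  cases i
  · exact Or.inl rfl
  · exact Or.inr rfl

theorem exists_pairLabel_eq {s t r : S} (h : r ∈ ({s, t} : Set S)) : ∃ i, pairLabel s t i = r := by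
  rcases h with rfl | h
  · exact ⟨false, rfl⟩
  · exact ⟨true, (Set.mem_singleton_iff.mp h).symm⟩

/-- The type of an edge, from the Boolean that tells whether it is dashed. -/
def EdgeKind.ofBool (b : Bool) : EdgeKind := if b then .dashed else .solid

theorem EdgeKind.ofBool_injective : Function.Injective EdgeKind.ofBool := by
  intro b b' h
  cases b <;> cases b' <;> first | rfl | cases h

/-- The digraph on the vertices of a `2 * m`-gon that consists of the two paths from `α_0`
to `β_m`, where the step from position `j` to position `j + 1` of path `i` has type `κ i j`. -/
def pathGraph (s t : S) (m : ℕ) (hm : 0 < m) (κ : Bool → ℕ → EdgeKind) :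
    LabeledMultigraph S (PolygonVertex m) where
  edges := {e | ∃ i j, j < m ∧ e = ⟨.path m hm i j, .path m hm i (j + 1),
    pairLabel s t (i ^^ j.bodd), κ i j⟩}

/-- The types of the edges of a polygon, in terms of the types of the edges at the ends. -/
def polygonKind {α : Type*} (m : ℕ) (d tl tr bl br : α) (i : Bool) (j : ℕ) : α :=
  if j = 0 then (if i then tr else tl) else if j + 1 = m then (if i then br else bl) else d

theorem pairLabel_bodd (s t : S) (j : ℕ) : pairLabel s t j.bodd = if Even j then s else t := by
  simp only [Nat.even_iff, Nat.mod_two_of_bodd, pairLabel]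
  cases j.bodd <;> rfl

theorem pairLabel_not_bodd (s t : S) (j : ℕ) :
    pairLabel s t (!j.bodd) = if Even j then t else s := by
  simp only [Nat.even_iff, Nat.mod_two_of_bodd, pairLabel]
  cases j.bodd <;> rfl

open PolygonVertex in
theorem polygon_eq_pathGraph (s t : S) {m : ℕ} (hm : 2 ≤ m) (tl tr bl br : EdgeKind) :
    polygon s t m tl tr bl br =
      pathGraph s t m (by omega) (polygonKind m .solid tl tr bl br) := by
  have hm0 : 0 < m := by omega
  have hL : ∀ j (h : j + 1 < m), (⟨path m hm0 false j, path m hm0 false (j + 1),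
      pairLabel s t (false ^^ j.bodd), polygonKind m .solid tl tr bl br false j⟩ :
        LabeledEdge S _) = ⟨alpha j (by omega), alpha (j + 1) h, if Even j then s else t,
          if j = 0 then tl else .solid⟩ := by
    intro j h
    rw [path_false (by omega), path_false h, Bool.false_xor, pairLabel_bodd, polygonKind,
      if_neg h.ne, if_neg Bool.false_ne_true]
  have hBL : ∀ h : 1 ≤ m, (⟨path m hm0 false (m - 1), path m hm0 false (m - 1 + 1),
      pairLabel s t (false ^^ (m - 1).bodd), polygonKind m .solid tl tr bl br false (m - 1)⟩ :
        LabeledEdge S _) = ⟨alpha (m - 1) (by omega), beta m h le_rfl, if Even m then t else s,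
          bl⟩ := by
    intro h
    have h1 : m - 1 + 1 = m := Nat.sub_add_cancel h
    have h2 : (m - 1).bodd = !m.bodd := by
      conv_rhs => rw [← h1, Nat.bodd_succ, Bool.not_not]
    rw [path_false (by omega), h1, path_last, Bool.false_xor, h2, pairLabel_not_bodd, polygonKind,
      if_neg (show m - 1 ≠ 0 by omega), if_pos h1, if_neg Bool.false_ne_true]
  have hTR : ∀ h : 1 ≤ m, (⟨path m hm0 true 0, path m hm0 true (0 + 1),
      pairLabel s t (true ^^ (0 : ℕ).bodd), polygonKind m .solid tl tr bl br true 0⟩ :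
        LabeledEdge S _) = ⟨alpha 0 (by omega), beta 1 le_rfl h, t, tr⟩ := by
    intro h
    rw [path_zero, path_true le_rfl h]
    rfl
  have hR : ∀ j (h : 1 ≤ j) (h' : j + 1 ≤ m), (⟨path m hm0 true j, path m hm0 true (j + 1),
      pairLabel s t (true ^^ j.bodd), polygonKind m .solid tl tr bl br true j⟩ :
        LabeledEdge S _) = ⟨beta j h (by omega), beta (j + 1) (by omega) h',
          if Even j then t else s, if j + 1 = m then br else .solid⟩ := by
    intro j h h'
    rw [path_true h (by omega), path_true (by omega) h', Bool.true_xor, pairLabel_not_bodd,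
      polygonKind, if_neg (show j ≠ 0 by omega), if_pos rfl]
  ext e
  constructor
  · rintro (⟨j, h⟩ | ⟨h⟩ | ⟨h⟩ | ⟨j, h, h'⟩)
    · exact ⟨false, j, by omega, (hL j h).symm⟩
    · exact ⟨false, m - 1, by omega, (hBL h).symm⟩
    · exact ⟨true, 0, by omega, (hTR h).symm⟩
    · exact ⟨true, j, by omega, (hR j h h').symm⟩
  · rintro ⟨i, j, hj, rfl⟩
    cases i
    · rcases Nat.lt_or_ge (j + 1) m with h | h
      · rw [hL j h]
        exact .left j h
      · obtain rfl : j = m - 1 := by omega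
        rw [hBL (by omega)]
        exact .bottomLeft _
    · rcases Nat.eq_zero_or_pos j with rfl | h
      · rw [hTR (by omega)]
        exact .topRight _
      · rw [hR j h hj]
        exact .right j h hj

open PolygonVertex in
theorem bigon_eq_pathGraph (s t : S) (k : EdgeKind) :
    bigon s t k = pathGraph s t 1 one_pos fun _ _ => k := by
  have h0 : ∀ i, path 1 one_pos i 0 = alpha 0 one_pos := path_zero
  have h1 : ∀ i, path 1 one_pos i (0 + 1) = beta 1 le_rfl le_rfl := path_last
  ext e
  constructor
  · rintro (rfl | rfl)
    · exact ⟨false, 0, one_pos, by rw [h0, h1]; rfl⟩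
    · exact ⟨true, 0, one_pos, by rw [h0, h1]; rfl⟩
  · rintro ⟨i, j, hj, rfl⟩
    obtain rfl : j = 0 := by omega
    rw [h0, h1]
    cases i
    · exact Or.inl rfl
    · exact Or.inr rfl

/-- The edges of the multigraph `Δ` are those of the two-coloured graph `G`, where the colours stand
for the labels `s` and `t`. -/
def DihedralGraph.Represents (G : DihedralGraph V) (s t : S) (Δ : LabeledMultigraph S V) : Prop :=
  ∀ e : LabeledEdge S V, e ∈ Δ.edges ↔ ∃ i, G.out i e.src = true ∧ e.tgt = G.flip i e.src ∧
    e.label = pairLabel s t i ∧ e.kind = EdgeKind.ofBool (G.dashed i e.src)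

namespace DihedralGraph

variable {G : DihedralGraph V} {s t : S} {Δ : LabeledMultigraph S V}

theorem Represents.exists_isBipath (hR : G.Represents s t Δ) (hst : s ≠ t) {m : ℕ} {hm : 0 < m}
    {κ : Bool → ℕ → EdgeKind} (h : Δ.IsIsomorphic (pathGraph s t m hm κ)) :
    ∃ v, (G.IsBipath v fun _ => m) ∧
      ∀ i, ∀ j < m, EdgeKind.ofBool (G.dashedStep v i j) = κ i j := by
  obtain ⟨φ, hφ⟩ := h
  set w : Bool → ℕ → V := fun i j => φ.symm (PolygonVertex.path m hm i j) with hw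
  have hstep : ∀ i, ∀ j < m, G.out (i ^^ j.bodd) (w i j) = true ∧
      w i (j + 1) = G.flip (i ^^ j.bodd) (w i j) ∧
      κ i j = EdgeKind.ofBool (G.dashed (i ^^ j.bodd) (w i j)) := by
    intro i j hj
    have h1 : (⟨w i j, w i (j + 1), pairLabel s t (i ^^ j.bodd), κ i j⟩ : LabeledEdge S V) ∈
        Δ.edges := by
      rw [hφ]
      exact ⟨i, j, hj, by simp [hw]⟩
    obtain ⟨l, h2, h3, h4, h5⟩ := (hR _).mp h1
    have h6 := pairLabel_injective hst h4
    subst h6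
    exact ⟨h2, h3, h5⟩
  have hwalk : ∀ i, ∀ j ≤ m, G.walk i j (φ.symm (.alpha 0 hm)) = w i j := by
    intro i j
    induction j with
    | zero => intro _; simp only [hw, PolygonVertex.path_zero, walk_zero]
    | succ j ih =>
      intro hj
      rw [walk_succ, ih (by omega), (hstep i j (by omega)).2.1]
  have hend : ∀ i, w i m = φ.symm (.beta m hm le_rfl) := fun i => by
    simp only [hw, PolygonVertex.path_last]
  refine ⟨φ.symm (.alpha 0 hm), ⟨fun _ => hm, fun i j hj => ?_, fun i i' => ?_, fun i l => ?_⟩,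
    fun i j hj => ?_⟩
  · rw [hwalk i j (le_of_lt hj)]
    exact (hstep i j hj).1
  · rw [hwalk i m le_rfl, hwalk i' m le_rfl, hend, hend]
  · -- the edge labeled `l` at the sink is the last one of one of the paths
    obtain ⟨k, rfl⟩ := Nat.exists_eq_add_of_le' hm
    rw [hwalk i _ le_rfl, hend, ← hend (l ^^ k.bodd)]
    have h1 := hstep (l ^^ k.bodd) k (by omega)
    rw [Bool.xor_assoc, Bool.xor_self, Bool.xor_false] at h1
    rw [h1.2.1, out_flip, h1.1]
    rfl
  · rw [dashedStep, hwalk i j hj.le]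
    exact (hstep i j hj).2.2.symm

theorem Represents.isIsomorphic (hR : G.Represents s t Δ) (hG : G.IsConnected) {m : ℕ}
    {hm : 0 < m} {κ : Bool → ℕ → EdgeKind} {v : V} (h : G.IsBipath v fun _ => m)
    (hκ : ∀ i, ∀ j < m, EdgeKind.ofBool (G.dashedStep v i j) = κ i j) :
    Δ.IsIsomorphic (pathGraph s t m hm κ) := by
  let ψ : PolygonVertex m → V
    | .alpha j _ => G.walk false j v
    | .beta j _ _ => G.walk true j v
  have hψ : ∀ i, ∀ j ≤ m, ψ (.path m hm i j) = G.walk i j v := by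
    intro i j hj
    cases i
    · rcases Nat.lt_or_ge j m with hj' | hj'
      · rw [PolygonVertex.path_false hj']
      · obtain rfl : j = m := by omega
        rw [PolygonVertex.path_last]
        exact h.meet true false
    · rcases Nat.eq_zero_or_pos j with rfl | h0
      · rw [PolygonVertex.path_zero]
        rfl
      · rw [PolygonVertex.path_true h0 hj]
  have hinj : Function.Injective ψ := by
    intro p p' hp
    obtain ⟨i, j, hj, rfl⟩ := p.exists_eq_path hm
    obtain ⟨i', j', hj', rfl⟩ := p'.exists_eq_path hm
    rw [hψ i j hj, hψ i' j' hj'] at hp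
    rcases h.walk_eq_walk hj hj' hp with ⟨rfl, rfl⟩ | ⟨rfl, rfl⟩ | ⟨rfl, rfl⟩
    · rw [PolygonVertex.path_zero, PolygonVertex.path_zero]
    · rw [PolygonVertex.path_last, PolygonVertex.path_last]
    · rfl
  have hsurj : Function.Surjective ψ := by
    intro w
    obtain ⟨i, j, hj, rfl⟩ := h.exists_eq_walk hG w
    exact ⟨_, hψ i j hj⟩
  refine ⟨(Equiv.ofBijective ψ ⟨hinj, hsurj⟩).symm, fun α β r k => ?_⟩
  obtain ⟨p, rfl⟩ := hsurj α
  obtain ⟨p', rfl⟩ := hsurj β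
  have hsymm : ∀ q, (Equiv.ofBijective ψ ⟨hinj, hsurj⟩).symm (ψ q) = q :=
    fun q => (Equiv.ofBijective ψ ⟨hinj, hsurj⟩).symm_apply_apply q
  rw [hsymm, hsymm, hR]
  constructor
  · rintro ⟨l, h1, h2, h3, h4⟩
    dsimp only at h1 h2 h3 h4
    obtain ⟨i, j, hj, rfl, rfl⟩ : ∃ i j, j < m ∧ p = .path m hm i j ∧ l = (i ^^ j.bodd) := by
      obtain ⟨i, j, hj, rfl⟩ := p.exists_eq_path hm
      rw [hψ i j hj] at h1
      have hjm : j < m := by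
        refine lt_of_le_of_ne hj fun hjm => ?_
        subst hjm
        rw [h.isSink i l] at h1
        cases h1
      cases j with
      | zero => exact ⟨l, 0, hm, by simp only [PolygonVertex.path_zero], by simp⟩
      | succ j =>
        refine ⟨i, j + 1, hjm, rfl, ?_⟩
        have h5 := h.out_last i (j := j) (by omega)
        rw [Nat.bodd_succ]
        by_contra hne
        have : l = (i ^^ j.bodd) := by
          revert hne
          cases l <;> cases i <;> cases j.bodd <;> simp
        rw [this, h5] at h1
        cases h1
    rw [hψ i j hj.le] at h2 h4
    refine ⟨i, j, hj, ?_⟩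
    have h5 : p' = .path m hm i (j + 1) := hinj (by rw [h2, hψ i (j + 1) hj, walk_succ])
    rw [h5, h3, h4, ← hκ i j hj]
    rfl
  · rintro ⟨i, j, hj, he⟩
    obtain ⟨rfl, rfl, rfl, rfl⟩ := LabeledEdge.mk.inj he
    refine ⟨i ^^ j.bodd, ?_, ?_, rfl, ?_⟩
    · dsimp only
      rw [hψ i j hj.le]
      exact h.out i j hj
    · dsimp only
      rw [hψ i j hj.le, hψ i (j + 1) hj, walk_succ]
    · dsimp only
      rw [hψ i j hj.le, ← hκ i j hj]
      rfl

theorem Represents.isIsomorphic_polygon_iff (hR : G.Represents s t Δ) (hst : s ≠ t)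
    (hG : G.IsConnected) {m : ℕ} (hm : 2 ≤ m) (tl tr bl br : Bool) :
    Δ.IsIsomorphic (polygon s t m (.ofBool tl) (.ofBool tr) (.ofBool bl) (.ofBool br)) ↔
      ∃ v, G.IsPolygonAt v m tl tr bl br := by
  have hk : ∀ i j, polygonKind m EdgeKind.solid (.ofBool tl) (.ofBool tr) (.ofBool bl)
      (.ofBool br) i j = .ofBool (polygonKind m false tl tr bl br i j) := by
    intro i j
    simp only [polygonKind]
    split_ifs <;> rfl
  rw [polygon_eq_pathGraph s t hm]
  constructor
  · intro h
    obtain ⟨v, hv, hd⟩ := hR.exists_isBipath hst h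
    exact ⟨v, hv, fun i j hj => EdgeKind.ofBool_injective ((hd i j hj).trans (hk i j))⟩
  · rintro ⟨v, hv⟩
    refine hR.isIsomorphic hG hv.isBipath fun i j hj => ?_
    rw [hk, hv.dashedStep i j hj]
    rfl

theorem Represents.isIsomorphic_bigon_iff (hR : G.Represents s t Δ) (hst : s ≠ t)
    (hG : G.IsConnected) (b : Bool) :
    Δ.IsIsomorphic (bigon s t (.ofBool b)) ↔
      ∃ v, (G.IsBipath v fun _ => 1) ∧ ∀ i, G.dashedStep v i 0 = b := by
  rw [bigon_eq_pathGraph]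
  constructor
  · intro h
    obtain ⟨v, hv, hd⟩ := hR.exists_isBipath hst h
    exact ⟨v, hv, fun i => EdgeKind.ofBool_injective (hd i 0 one_pos)⟩
  · rintro ⟨v, hv, hd⟩
    refine hR.isIsomorphic hG hv fun i j hj => ?_
    obtain rfl : j = 0 := by omega
    rw [hd]

theorem Represents.isAdmissible_iff (hR : G.Represents s t Δ) (hst : s ≠ t) (hG : G.IsConnected)
    (n : ℕ) : _root_.IsAdmissible s t n Δ ↔ G.IsAdmissible n := by
  have hp := fun {m : ℕ} (hm : 2 ≤ m) => hR.isIsomorphic_polygon_iff hst hG hm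
  have h7 := hR.isIsomorphic_bigon_iff hst hG false
  have h8 := hR.isIsomorphic_bigon_iff hst hG true
  have hp1 := fun {m : ℕ} (hm : 2 ≤ m) => hp hm false false false false
  have hp2 := fun {m : ℕ} (hm : 2 ≤ m) => hp hm true false false true
  have hp3 := fun {m : ℕ} (hm : 2 ≤ m) => hp hm false true true false
  have hp4 := fun {m : ℕ} (hm : 2 ≤ m) => hp hm true true false false
  have hp5 := fun {m : ℕ} (hm : 2 ≤ m) => hp hm false false true true
  have hp6 := fun {m : ℕ} (hm : 2 ≤ m) => hp hm true true true true
  constructor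
  · rintro (⟨m, hm, hd, h | h | h⟩ | ⟨m, hm, hd, h | h⟩ | ⟨m, hm, hd, h⟩ | h | h)
    · obtain ⟨v, hv⟩ := (hp1 hm).mp h
      exact Or.inl ⟨v, m, hm, hd, Or.inl hv⟩
    · obtain ⟨v, hv⟩ := (hp2 hm).mp h
      exact Or.inl ⟨v, m, hm, hd, Or.inr (Or.inl hv)⟩
    · obtain ⟨v, hv⟩ := (hp3 hm).mp h
      exact Or.inl ⟨v, m, hm, hd, Or.inr (Or.inr hv)⟩
    · obtain ⟨v, hv⟩ := (hp4 hm).mp h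
      exact Or.inr (Or.inl ⟨v, m, hm, hd, Or.inl hv⟩)
    · obtain ⟨v, hv⟩ := (hp5 hm).mp h
      exact Or.inr (Or.inl ⟨v, m, hm, hd, Or.inr hv⟩)
    · obtain ⟨v, hv⟩ := (hp6 hm).mp h
      exact Or.inr (Or.inr (Or.inl ⟨v, m, hm, hd, hv⟩))
    · obtain ⟨v, hv, hd⟩ := h7.mp h
      exact Or.inr (Or.inr (Or.inr ⟨v, hv, by rw [hd, hd]⟩))
    · obtain ⟨v, hv, hd⟩ := h8.mp h
      exact Or.inr (Or.inr (Or.inr ⟨v, hv, by rw [hd, hd]⟩))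
  · rintro (⟨v, m, hm, hd, h | h | h⟩ | ⟨v, m, hm, hd, h | h⟩ | ⟨v, m, hm, hd, h⟩ | ⟨v, hv, hd⟩)
    · exact Or.inl ⟨m, hm, hd, Or.inl ((hp1 hm).mpr ⟨v, h⟩)⟩
    · exact Or.inl ⟨m, hm, hd, Or.inr (Or.inl ((hp2 hm).mpr ⟨v, h⟩))⟩
    · exact Or.inl ⟨m, hm, hd, Or.inr (Or.inr ((hp3 hm).mpr ⟨v, h⟩))⟩
    · exact Or.inr (Or.inl ⟨m, hm, hd, Or.inl ((hp4 hm).mpr ⟨v, h⟩)⟩)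
    · exact Or.inr (Or.inl ⟨m, hm, hd, Or.inr ((hp5 hm).mpr ⟨v, h⟩)⟩)
    · exact Or.inr (Or.inr (Or.inl ⟨m, hm, hd, (hp6 hm).mpr ⟨v, h⟩⟩))
    · refine Or.inr (Or.inr (Or.inr ?_))
      cases h0 : G.dashedStep v false 0
      · exact Or.inl (h7.mpr ⟨v, hv, Bool.forall_bool.mpr ⟨h0, by rw [← hd, h0]⟩⟩)
      · exact Or.inr (h8.mpr ⟨v, hv, Bool.forall_bool.mpr ⟨h0, by rw [← hd, h0]⟩⟩)

end DihedralGraph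

end PathGraph

namespace LabeledMultigraph

/-! ### From labeled digraphs to two-coloured graphs -/

section TwoColored

variable {S V : Type*} {Γ : LabeledMultigraph S V} (hΓ : Γ.IsLabeledDigraph)

theorem edge_spec (r : S) (α : V) : hΓ.edge r α ∈ Γ.edges ∧ (hΓ.edge r α).label = r ∧
    ((hΓ.edge r α).src = α ∨ (hΓ.edge r α).tgt = α) :=
  (hΓ.existsUnique_edge r α).choose_spec.1

open Classical in
/-- The other end of the edge labeled `r` at `α`. -/
noncomputable def otherEnd (r : S) (α : V) : V :=
  if (hΓ.edge r α).src = α then (hΓ.edge r α).tgt else (hΓ.edge r α).src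

theorem otherEnd_mem (r : S) (α : V) : (hΓ.edge r α).src = otherEnd hΓ r α ∨
    (hΓ.edge r α).tgt = otherEnd hΓ r α := by
  rw [otherEnd]
  split_ifs
  · exact Or.inr rfl
  · exact Or.inl rfl

theorem edge_otherEnd (r : S) (α : V) : hΓ.edge r (otherEnd hΓ r α) = hΓ.edge r α := by
  have h := edge_eq hΓ (edge_spec hΓ r α).1 (otherEnd_mem hΓ r α)
  rwa [(edge_spec hΓ r α).2.1] at h

theorem otherEnd_eq_iff (r : S) (α : V) :
    (hΓ.edge r α).src = otherEnd hΓ r α ↔ (hΓ.edge r α).src ≠ α := by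
  have hne := hΓ.no_loops _ (edge_spec hΓ r α).1
  rw [otherEnd]
  split_ifs with h
  · exact iff_of_false hne (not_not_intro h)
  · simp [h]

open Classical in
/-- The two-coloured graph formed by the edges with the labels `s` (colour `false`) and `t`
(colour `true`). -/
noncomputable def twoColored (s t : S) : DihedralGraph V where
  flip i := otherEnd hΓ (pairLabel s t i)
  out i α := decide ((hΓ.edge (pairLabel s t i) α).src = α)
  dashed i α := match (hΓ.edge (pairLabel s t i) α).kind with
    | .solid => false
    | .dashed => true
  flip_flip i α := by
    generalize pairLabel s t i = r
    rcases (edge_spec hΓ r α).2.2 with h | h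
    · have h1 : otherEnd hΓ r α = (hΓ.edge r α).tgt := if_pos h
      have h2 : (hΓ.edge r α).src ≠ otherEnd hΓ r α := by
        rw [h1]; exact hΓ.no_loops _ (edge_spec hΓ r α).1
      rw [otherEnd, edge_otherEnd, if_neg h2, h]
    · have h0 : (hΓ.edge r α).src ≠ α := by
        have := hΓ.no_loops _ (edge_spec hΓ r α).1
        rwa [h] at this
      have h1 : otherEnd hΓ r α = (hΓ.edge r α).src := if_neg h0
      rw [otherEnd, edge_otherEnd, if_pos h1.symm, h]
  flip_ne i α := by
    intro h
    have h1 := otherEnd_eq_iff hΓ (pairLabel s t i) α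
    rw [h] at h1
    exact iff_not_self h1
  out_flip i α := by
    rw [edge_otherEnd]
    simp only [otherEnd_eq_iff, ne_eq, decide_not]
  dashed_flip i α := by rw [edge_otherEnd]

theorem tau_pairLabel (s t : S) (i : Bool) :
    tau hΓ (pairLabel s t i) = (twoColored hΓ s t).op u i := by
  refine Finsupp.lhom_ext' fun α => LinearMap.ext_ring ?_
  have h1 := tau_vec hΓ (pairLabel s t i) α
  rw [vec] at h1
  change tau hΓ (pairLabel s t i) (Finsupp.single α 1) =
    (twoColored hΓ s t).op u i (Finsupp.single α 1)
  rw [h1, DihedralGraph.op_single]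
  by_cases h : (hΓ.edge (pairLabel s t i) α).src = α <;>
    cases hk : (hΓ.edge (pairLabel s t i) α).kind <;>
    simp [tauVec, DihedralGraph.weight, twoColored, otherEnd, vec, h, hk]

theorem mem_edges_iff (s t : S) (i : Bool) {e : LabeledEdge S V}
    (he : e.label = pairLabel s t i) : e ∈ Γ.edges ↔ (twoColored hΓ s t).out i e.src = true ∧
      e.tgt = (twoColored hΓ s t).flip i e.src ∧
      e.kind = EdgeKind.ofBool ((twoColored hΓ s t).dashed i e.src) := by
  constructor
  · intro h
    have h1 := edge_eq hΓ h (Or.inl rfl)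
    rw [he] at h1
    simp only [twoColored, otherEnd, h1, if_true, decide_true, true_and]
    cases e.kind <;> rfl
  · rintro ⟨h1, h2, h3⟩
    have h4 := edge_spec hΓ (pairLabel s t i) e.src
    simp only [twoColored, otherEnd, decide_eq_true_eq] at h1 h2 h3
    rw [if_pos h1] at h2
    have h5 : e = hΓ.edge (pairLabel s t i) e.src := by
      refine LabeledEdge.ext h1.symm h2 (he.trans h4.2.1.symm) ?_
      rw [h3]
      cases (hΓ.edge (pairLabel s t i) e.src).kind <;> rfl
    rw [h5]
    exact h4.1

theorem adj_flip (s t : S) (i : Bool) (α : V) :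
    (Γ.restrict {s, t}).underlying.Adj α ((twoColored hΓ s t).flip i α) := by
  have hmem := edge_spec hΓ (pairLabel s t i) α
  have hr : hΓ.edge (pairLabel s t i) α ∈ (Γ.restrict {s, t}).edges :=
    ⟨hmem.1, by rw [hmem.2.1]; exact pairLabel_mem s t i⟩
  refine ⟨((twoColored hΓ s t).flip_ne i α).symm, ?_⟩
  by_cases h : (hΓ.edge (pairLabel s t i) α).src = α
  · exact Or.inl ⟨_, hr, h, (if_pos h).symm⟩
  · exact Or.inr ⟨_, hr, (if_neg h).symm, hmem.2.2.resolve_left h⟩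

theorem exists_eq_flip_of_adj {s t : S} {α β : V}
    (h : (Γ.restrict {s, t}).underlying.Adj α β) :
    ∃ i, β = (twoColored hΓ s t).flip i α := by
  have key : ∀ e ∈ (Γ.restrict {s, t}).edges, ∃ i, e.tgt = (twoColored hΓ s t).flip i e.src := by
    rintro e ⟨he, hl⟩
    obtain ⟨i, hi⟩ := exists_pairLabel_eq hl
    exact ⟨i, ((mem_edges_iff hΓ s t i hi.symm).mp he).2.1⟩
  rcases h.2 with ⟨e, he, rfl, rfl⟩ | ⟨e, he, rfl, rfl⟩
  · exact key e he
  · obtain ⟨i, hi⟩ := key e he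
    exact ⟨i, by rw [hi, DihedralGraph.flip_flip]⟩

variable {s t : S} (C : (Γ.restrict {s, t}).underlying.ConnectedComponent)

theorem flip_mem_supp (i : Bool) {α : V} (hα : α ∈ C.supp) :
    (twoColored hΓ s t).flip i α ∈ C.supp := by
  rw [SimpleGraph.ConnectedComponent.mem_supp_iff] at hα ⊢
  rw [← hα]
  exact SimpleGraph.ConnectedComponent.sound (adj_flip hΓ s t i α).symm.reachable

/-- The two-coloured graph of a connected component. -/
noncomputable def componentGraph : DihedralGraph C.supp where
  flip i α := ⟨(twoColored hΓ s t).flip i α, flip_mem_supp hΓ C i α.2⟩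
  out i α := (twoColored hΓ s t).out i α
  dashed i α := (twoColored hΓ s t).dashed i α
  flip_flip i α := Subtype.ext ((twoColored hΓ s t).flip_flip i α)
  flip_ne i α h := (twoColored hΓ s t).flip_ne i α (congrArg Subtype.val h)
  out_flip i α := (twoColored hΓ s t).out_flip i α
  dashed_flip i α := (twoColored hΓ s t).dashed_flip i α

theorem isEmbedding_componentGraph :
    DihedralGraph.IsEmbedding (componentGraph hΓ C) (twoColored hΓ s t) Subtype.val :=
  ⟨Subtype.val_injective, fun _ _ => rfl, fun _ _ => rfl, fun _ _ => rfl⟩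

theorem isConnected_componentGraph : (componentGraph hΓ C).IsConnected := by
  rintro A ⟨α, hα⟩ hA
  rw [Set.eq_univ_iff_forall]
  intro β
  have hreach : (Γ.restrict {s, t}).underlying.Reachable α β :=
    SimpleGraph.ConnectedComponent.exact (α.2.trans β.2.symm)
  rw [SimpleGraph.reachable_iff_reflTransGen] at hreach
  have key : ∀ γ : V, Relation.ReflTransGen (Γ.restrict {s, t}).underlying.Adj α γ →
      ∃ h : γ ∈ C.supp, (⟨γ, h⟩ : C.supp) ∈ A := by
    intro γ hγ
    induction hγ with
    | refl => exact ⟨α.2, hα⟩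
    | tail _ hadj ih =>
      obtain ⟨h, hmem⟩ := ih
      obtain ⟨i, rfl⟩ := exists_eq_flip_of_adj hΓ hadj
      exact ⟨flip_mem_supp hΓ C i h, hA i _ hmem⟩
  exact (key β hreach).2

theorem represents_componentGraph :
    (componentGraph hΓ C).Represents s t ((Γ.restrict {s, t}).component C) := by
  intro e
  change (⟨e.src, e.tgt, e.label, e.kind⟩ : LabeledEdge S V) ∈ Γ.edges ∧ e.label ∈ ({s, t} : Set S)
    ↔ _
  constructor
  · rintro ⟨he, hl⟩
    obtain ⟨i, hi⟩ := exists_pairLabel_eq hl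
    obtain ⟨h1, h2, h3⟩ := (mem_edges_iff hΓ s t i hi.symm).mp he
    exact ⟨i, h1, Subtype.ext h2, hi.symm, h3⟩
  · rintro ⟨i, h1, h2, h3, h4⟩
    refine ⟨(mem_edges_iff hΓ s t i h3).mpr ⟨h1, congrArg Subtype.val h2, h4⟩, ?_⟩
    rw [h3]
    exact pairLabel_mem s t i

theorem braid_twoColored_iff (n : ℕ) : (twoColored hΓ s t).Braid u n ↔
    ∀ C : (Γ.restrict {s, t}).underlying.ConnectedComponent,
      (componentGraph hΓ C).Braid u n := by
  refine ⟨fun h C => h.of_isEmbedding (isEmbedding_componentGraph hΓ C), fun h => ?_⟩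
  refine Finsupp.lhom_ext' fun α => LinearMap.ext_ring ?_
  set C := (Γ.restrict {s, t}).underlying.connectedComponentMk α with hC
  have h1 := (isEmbedding_componentGraph hΓ C).map_altDiff u n
    (Finsupp.single (⟨α, rfl⟩ : C.supp) 1)
  rw [show altDiff ((componentGraph hΓ C).op u) n = 0 from h C, LinearMap.zero_apply, map_zero,
    Finsupp.lmapDomain_apply, Finsupp.mapDomain_single] at h1
  exact h1.symm

theorem braid_iff_isAdmissible (hst : s ≠ t) {n : ℕ} (hn : 0 < n) :
    altProd (tau hΓ s) (tau hΓ t) n = altProd (tau hΓ t) (tau hΓ s) n ↔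
      ∀ C : (Γ.restrict {s, t}).underlying.ConnectedComponent,
        IsAdmissible s t n ((Γ.restrict {s, t}).component C) := by
  have h1 : tau hΓ s = (twoColored hΓ s t).op u false := tau_pairLabel hΓ s t false
  have h2 : tau hΓ t = (twoColored hΓ s t).op u true := tau_pairLabel hΓ s t true
  have h3 : (twoColored hΓ s t).Braid u n ↔ _ := braid_twoColored_iff hΓ n
  rw [h1, h2]
  refine (altProd_eq_iff ((twoColored hΓ s t).op u) n).trans (h3.trans ?_)
  refine forall_congr' fun C => ?_
  have hG := isConnected_componentGraph hΓ C
  rw [(represents_componentGraph hΓ C).isAdmissible_iff hst hG]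
  have : Nonempty C.supp := C.nonempty_supp.to_subtype
  exact ⟨fun h => h.isAdmissible hn hG, fun h => h.braid hG⟩

end TwoColored

/-! ### Representations of the Hecke algebra -/

theorem map_altProd {A B F : Type*} [Monoid A] [Monoid B] [FunLike F A B] [MonoidHomClass F A B]
    (f : F) (a b : A) (n : ℕ) : f (altProd a b n) = altProd (f a) (f b) n := by
  induction n generalizing a b with
  | zero => exact map_one f
  | succ n ih => rw [altProd, map_mul, ih, altProd]

theorem sub_mul_add_one_eq_zero {R A : Type*} [CommRing R] [Ring A] [Algebra R A] {a : A} {q : R}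
    (h : a * a = (q - 1) • a + q • 1) : (a - q • 1) * (a + 1) = 0 := by
  rw [sub_mul, mul_add, mul_one, h, smul_one_mul]
  module

theorem isWDigraph_iff {S W V : Type*} [Group W] {M : CoxeterMatrix S} (cs : CoxeterSystem M W)
    (Γ : LabeledMultigraph S V) :
    Γ.IsWDigraph cs ↔ ∃ hΓ : Γ.IsLabeledDigraph, ∀ s t, 1 < M s t →
      altProd (tau hΓ s) (tau hΓ t) (M s t) = altProd (tau hΓ t) (tau hΓ s) (M s t) := by
  constructor
  · rintro ⟨hΓ, ρ, hρ⟩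
    refine ⟨hΓ, fun s t h => ?_⟩
    have h1 := congrArg ρ (RingQuot.mkAlgHom_rel Qu (HeckeRel.braid s t h))
    rw [map_altProd, map_altProd, map_altProd, map_altProd] at h1
    have h2 : ∀ r, ρ (RingQuot.mkAlgHom Qu (HeckeRel M) (FreeAlgebra.ι Qu r)) = tau hΓ r := hρ
    rwa [h2, h2] at h1
  · rintro ⟨hΓ, hb⟩
    have hrel : ∀ ⦃x y : FreeAlgebra Qu S⦄, HeckeRel M x y →
        FreeAlgebra.lift Qu (tau hΓ) x = FreeAlgebra.lift Qu (tau hΓ) y := by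
      rintro _ _ (⟨s⟩ | ⟨s, t, h⟩)
      · have h1 : tau hΓ s = (twoColored hΓ s s).op u false := tau_pairLabel hΓ s s false
        have h2 := (twoColored hΓ s s).op_mul_op u false
        rw [← h1] at h2
        rw [map_mul, map_sub, map_add, map_one, map_zero, AlgHom.commutes, FreeAlgebra.lift_ι_apply,
          Algebra.algebraMap_eq_smul_one]
        exact sub_mul_add_one_eq_zero h2
      · rw [map_altProd, map_altProd, FreeAlgebra.lift_ι_apply, FreeAlgebra.lift_ι_apply]
        exact hb s t h
    refine ⟨hΓ, RingQuot.liftAlgHom Qu ⟨FreeAlgebra.lift Qu (tau hΓ), hrel⟩, fun s => ?_⟩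
    rw [HeckeAlgebra.T, RingQuot.liftAlgHom_mkAlgHom_apply, FreeAlgebra.lift_ι_apply]

end LabeledMultigraph

theorem theorem1 {S W V : Type*} [Group W] {M : CoxeterMatrix S} (cs : CoxeterSystem M W)
    (Γ : LabeledMultigraph S V) :
    Γ.IsWDigraph cs ↔
      Γ.IsLabeledDigraph ∧
        ∀ s t : S, 1 < M s t →
          ∀ C : (Γ.restrict {s, t}).underlying.ConnectedComponent,
            IsAdmissible s t (M s t) ((Γ.restrict {s, t}).component C) := by
  have hne : ∀ s t : S, 1 < M s t → s ≠ t := by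
    rintro s _ h rfl
    rw [M.diagonal] at h
    exact lt_irrefl 1 h
  rw [LabeledMultigraph.isWDigraph_iff, ← exists_prop]
  exact exists_congr fun hΓ => forall₃_congr fun s t h =>
    LabeledMultigraph.braid_iff_isAdmissible hΓ (hne s t h) (by omega)
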